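/- Setting. All Hilbert spaces are finite-dimensional and complex, $\mathrm{L}(A)$ denotes the linear operators on $A$, and $X^{*}$ is the conjugate transpose. Let $f:(0,\infty)\to[0,\infty)$ be operator monotone ($f(P)\le f(Q)$ for all positive definite matrices $P\le Q$ of any size) and normalized ($f(1)=1$). Put $f(0^{+})=\lim_{x\downarrow 0}f(x)$, $f'(+\infty)=\lim_{x\to\infty}f(x)/x$, and $$P_f(x,y)=\begin{cases} y f(x/y), & x,y>0,\\ y f(0^{+}), & x=0,\\ x f'(+\infty), & y=0.\end{cases}$$ For a positive semidefinite $\sigma\in \mathrm{L}(A)$ with spectral decomposition $\sigma=\sum_i\lambda_iQ_i$ let $\mathbf{J}_{f,\sigma}(X)=\sum_{i,j}P_f(\lambda_i,\lambda_j)\,Q_iXQ_j$ and $\langle X,Y\rangle_{f,\sigma}=\mathrm{Tr}[X^{*}\mathbf{J}_{f,\sigma}(Y)]$. For an operator $\rho_{AB}$ on $A\otimes B$ with positive semidefinite marginals $\rho_A=\mathrm{Tr}_B\rho_{AB}$ and $\rho_B=\mathrm{Tr}_A\rho_{AB}$, define $$\mu_f(A:B)_\rho=\sup\ \bigl|\mathrm{Tr}[(X\otimes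 Y^{*})\rho_{AB}]\bigr|$$ over Hermitian $X\in \mathrm{L}(A)$, $Y\in \mathrm{L}(B)$ such that $\langle \mathbb 1,X\rangle_{f,\rho_A}=\langle \mathbb 1,Y\rangle_{f,\rho_B}=0$ and $\langle X,X\rangle_{f,\rho_A}=\langle Y,Y\rangle_{f,\rho_B}=1$; let $\mu_f^{\mathrm{Lin}}(A:B)_\rho$ be the same supremum over all $X\in \mathrm{L}(A)$, $Y\in \mathrm{L}(B)$ satisfying these constraints. A supremum over the empty set is $0$. A unital Schwarz map is a linear positive map $\mathcal M$ with $\mathcal M(\mathbb 1)=\mathbb 1$ and $\mathcal M(X^{*}X)\ge \mathcal M(X)^{*}\mathcal M(X)$ for all $X$; adjoints of maps are taken with respect to the Hilbert–Schmidt inner product $\mathrm{Tr}[X^{*}Y]$. Theorem. Let $f:(0,\infty)\to[0,\infty)$ be a normalized operator monotone function. For every density matrix $\rho_{AB}$ the numbers $\mu_f(A:B)_\rho$ and $\mu_f^{\mathrm{Lin}}(A:B)_\rho$ are finite, and the following hold. 1. (Data processing.) If $\rho_{AB}$ is a density matrix and $\mathcal E_{A\to A'}$, $\mathcal F_{B\to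 B'}$ are adjoints of unital Schwarz maps, then $$\mu_f(A':B')_{(\mathcal E\otimes\mathcal F)(\rho)}\le\mu_f(A:B)_\rho,\qquad \mu_f^{\mathrm{Lin}}(A':B')_{(\mathcal E\otimes\mathcal F)(\rho)}\le\mu_f^{\mathrm{Lin}}(A:B)_\rho .$$ 2. (Isometric invariance.) If $\rho_{AB}$ is a density matrix and $V_{A\to A'}$, $W_{B\to B'}$ are isometries, then, with $\rho'=(V\otimes W)\rho_{AB}(V^{*}\otimes W^{*})$, $$\mu_f(A:B)_\rho=\mu_f(A':B')_{\rho'},\qquad \mu_f^{\mathrm{Lin}}(A:B)_\rho=\mu_f^{\mathrm{Lin}}(A':B')_{\rho'} .$$ 3. (Classical case.) If $p_{XY}$ is a probability distribution on a finite set $\mathcal X\times\mathcal Y$ and $\rho_{AB}=\sum_{x,y}p(x,y)\,|x\rangle\langle x|\otimes|y\rangle\langle y|$, then $$\mu_f(X:Y)_p=\mu_f^{\mathrm{Lin}}(X:Y)_p=\mu(X:Y)_p,$$ where $\mu(X:Y)_p=\sup|\mathbb E[g(X)h(Y)]|$ over $g:\mathcal X\to\mathbb R$, $h:\mathcal Y\to\mathbb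 R$ with $\mathbb E[g(X)]=\mathbb E[h(Y)]=0$ and $\mathbb E[g(X)^2]=\mathbb E[h(Y)^2]=1$ is the Hirschfeld–Gebelein–Rényi maximal correlation (again $0$ if no such $g,h$ exist). -/

import Mathlib

open scoped Kronecker Matrix Topology ENNReal ComplexOrder

namespace MaxCorr

noncomputable section

/-- Operator monotonicity of `f` on the open half-line `(0, ∞)`: for positive definite matrices
`A ≤ B` (of any size) one has `f(A) ≤ f(B)` in the Löwner order. Only the values of `f` on
`(0, ∞)` matter. -/
def OperatorMonotone (f : ℝ → ℝ) : Prop :=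
  ∀ (n : ℕ) (A B : Matrix (Fin n) (Fin n) ℂ), A.PosDef → B.PosDef →
    (B - A).PosSemidef → (cfc f B - cfc f A).PosSemidef

/-- A function `f : (0, ∞) → [0, ∞)` that is normalized, `f 1 = 1`, and operator monotone. -/
structure NormalizedOperatorMonotone (f : ℝ → ℝ) : Prop where
  nonneg : ∀ x, 0 < x → 0 ≤ f x
  normalized : f 1 = 1
  monotone : OperatorMonotone f

/-- The perspective `P_f` on `[0, ∞) × [0, ∞)`: it is `y f(x / y)` for `x, y > 0`, `y f(0⁺)` for
`x = 0`, and `x f'(+∞)` for `y = 0`, where `f(0⁺) = lim_{t ↓ 0} f t` and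
`f'(+∞) = lim_{t → ∞} f t / t`. Both limits exist for operator monotone `f ≥ 0`. -/
def perspective (f : ℝ → ℝ) (x y : ℝ) : ℝ :=
  if 0 < x ∧ 0 < y then y * f (x / y)
  else if x = 0 then y * Filter.limUnder (𝓝[>] (0 : ℝ)) f
  else x * Filter.limUnder Filter.atTop (fun t : ℝ => f t / t)

/-- A density matrix. -/
def IsState {a : Type*} [Fintype a] (ρ : Matrix a a ℂ) : Prop :=
  ρ.PosSemidef ∧ ρ.trace = 1

/-- For Hermitian `σ`, the orthogonal projection onto the eigenspace of `σ` for the eigenvalue `l`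
(it is `0` if `l` is not an eigenvalue). -/
def spectralProj {a : Type*} [Fintype a] [DecidableEq a] (σ : Matrix a a ℂ) (l : ℝ) :
    Matrix a a ℂ :=
  cfc (fun t : ℝ => if t = l then (1 : ℝ) else 0) σ

/-- `J_{f,σ}(X) = ∑_{l, m} P_f(l, m) Q_l X Q_m`, the sum over pairs of eigenvalues of `σ`, with
`Q_l` the spectral projections of `σ`. -/
def J {a : Type*} [Fintype a] [DecidableEq a] (f : ℝ → ℝ) (σ X : Matrix a a ℂ) :
    Matrix a a ℂ :=
  ∑ l ∈ (Matrix.finite_real_spectrum (A := σ)).toFinset,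
    ∑ m ∈ (Matrix.finite_real_spectrum (A := σ)).toFinset,
      ((perspective f l m : ℝ) : ℂ) • (spectralProj σ l * X * spectralProj σ m)

/-- `⟨X, Y⟩_{f,σ} = Tr[X* J_{f,σ}(Y)]`. -/
def innerF {a : Type*} [Fintype a] [DecidableEq a] (f : ℝ → ℝ) (σ X Y : Matrix a a ℂ) : ℂ :=
  (Xᴴ * J f σ Y).trace

/-- The marginal `ρ_A = Tr_B ρ_{AB}`. -/
def marginalA {a b : Type*} [Fintype b] (ρ : Matrix (a × b) (a × b) ℂ) : Matrix a a ℂ :=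
  Matrix.of fun i j => ∑ k, ρ (i, k) (j, k)

/-- The marginal `ρ_B = Tr_A ρ_{AB}`. -/
def marginalB {a b : Type*} [Fintype a] (ρ : Matrix (a × b) (a × b) ℂ) : Matrix b b ℂ :=
  Matrix.of fun i j => ∑ k, ρ (k, i) (k, j)

/-- The constraints on one observable: mean `⟨1, X⟩_{f,σ} = 0` and second moment
`⟨X, X⟩_{f,σ} = 1`. -/
def Feasible {a : Type*} [Fintype a] [DecidableEq a] (f : ℝ → ℝ) (σ X : Matrix a a ℂ) : Prop :=
  innerF f σ 1 X = 0 ∧ innerF f σ X X = 1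

/-- The `f`-maximal correlation coefficient `μ_f(A:B)_ρ`: the supremum of `|Tr[(X ⊗ Y*) ρ]|` over
feasible Hermitian `X`, `Y`. It takes values in `[0, ∞]`, so the supremum over an empty feasible
set is `0`. -/
def mu {a b : Type*} [Fintype a] [DecidableEq a] [Fintype b] [DecidableEq b]
    (f : ℝ → ℝ) (ρ : Matrix (a × b) (a × b) ℂ) : ℝ≥0∞ :=
  ⨆ (X : Matrix a a ℂ) (Y : Matrix b b ℂ) (_ : X.IsHermitian) (_ : Y.IsHermitian)
    (_ : Feasible f (marginalA ρ) X) (_ : Feasible f (marginalB ρ) Y),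
    ‖((X ⊗ₖ Yᴴ) * ρ).trace‖ₑ

/-- `μ_f^Lin(A:B)_ρ`: the same supremum over all feasible matrices `X`, `Y`. -/
def muLin {a b : Type*} [Fintype a] [DecidableEq a] [Fintype b] [DecidableEq b]
    (f : ℝ → ℝ) (ρ : Matrix (a × b) (a × b) ℂ) : ℝ≥0∞ :=
  ⨆ (X : Matrix a a ℂ) (Y : Matrix b b ℂ)
    (_ : Feasible f (marginalA ρ) X) (_ : Feasible f (marginalB ρ) Y),
    ‖((X ⊗ₖ Yᴴ) * ρ).trace‖ₑ

/-- A unital Schwarz map between full matrix algebras. -/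
structure IsUnitalSchwarz {a b : Type*} [Fintype a] [DecidableEq a] [Fintype b] [DecidableEq b]
    (M : Matrix a a ℂ →ₗ[ℂ] Matrix b b ℂ) : Prop where
  map_one : M 1 = 1
  positive : ∀ X : Matrix a a ℂ, X.PosSemidef → (M X).PosSemidef
  schwarz : ∀ X : Matrix a a ℂ, (M (Xᴴ * X) - (M X)ᴴ * M X).PosSemidef

/-- `M` is the adjoint of `E` for the Hilbert–Schmidt inner product `⟨X, Y⟩ = Tr[X* Y]`. -/
def IsHSAdjoint {a b : Type*} [Fintype a] [Fintype b]
    (E : Matrix a a ℂ →ₗ[ℂ] Matrix b b ℂ) (M : Matrix b b ℂ →ₗ[ℂ] Matrix a a ℂ) : Prop :=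
  ∀ (X : Matrix a a ℂ) (Y : Matrix b b ℂ), ((E X)ᴴ * Y).trace = (Xᴴ * M Y).trace

/-- `E` is the Hilbert–Schmidt adjoint of a unital Schwarz map. -/
def IsAdjointOfUnitalSchwarz {a b : Type*} [Fintype a] [DecidableEq a] [Fintype b]
    [DecidableEq b] (E : Matrix a a ℂ →ₗ[ℂ] Matrix b b ℂ) : Prop :=
  ∃ M : Matrix b b ℂ →ₗ[ℂ] Matrix a a ℂ, IsUnitalSchwarz M ∧ IsHSAdjoint E M

/-- The tensor product `E ⊗ F` of linear maps between matrix algebras, under the identification of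
`L(A) ⊗ L(B)` with `L(A ⊗ B)` by the Kronecker product. -/
def tensorMap {a b a' b' : Type*} [Fintype a] [DecidableEq a] [Fintype b] [DecidableEq b]
    [Fintype a'] [DecidableEq a'] [Fintype b'] [DecidableEq b']
    (E : Matrix a a ℂ →ₗ[ℂ] Matrix a' a' ℂ) (F : Matrix b b ℂ →ₗ[ℂ] Matrix b' b' ℂ) :
    Matrix (a × b) (a × b) ℂ →ₗ[ℂ] Matrix (a' × b') (a' × b') ℂ :=
  (kroneckerLinearEquiv a' a' b' b' ℂ).toLinearMap ∘ₗ TensorProduct.map E F ∘ₗ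
    (kroneckerLinearEquiv a a b b ℂ).symm.toLinearMap

/-- A probability distribution on a finite type. -/
def IsDistribution {x : Type*} [Fintype x] (p : x → ℝ) : Prop :=
  (∀ i, 0 ≤ p i) ∧ ∑ i, p i = 1

/-- The classical state `∑_{x,y} p(x,y) |x⟩⟨x| ⊗ |y⟩⟨y|`. -/
def classicalState {a b : Type*} [DecidableEq a] [DecidableEq b] (p : a × b → ℝ) :
    Matrix (a × b) (a × b) ℂ :=
  Matrix.diagonal fun z => (p z : ℂ)

/-- The Hirschfeld–Gebelein–Rényi maximal correlation of a joint distribution `p` of `(X, Y)`: the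
supremum of `|E[g(X) h(Y)]|` over real functions `g`, `h` with `E[g(X)] = E[h(Y)] = 0` and
`E[g(X)²] = E[h(Y)²] = 1`. Expectations under the marginals are written as sums against `p`. -/
def classicalMaxCorr {a b : Type*} [Fintype a] [Fintype b] (p : a × b → ℝ) : ℝ≥0∞ :=
  ⨆ (g : a → ℝ) (h : b → ℝ)
    (_ : ∑ z, p z * g z.1 = 0) (_ : ∑ z, p z * h z.2 = 0)
    (_ : ∑ z, p z * g z.1 ^ 2 = 1) (_ : ∑ z, p z * h z.2 ^ 2 = 1),
    ‖∑ z, p z * (g z.1 * h z.2)‖ₑ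

end

end MaxCorr

/-!
The heart of the matter is Petz monotonicity (`IsUnitalSchwarz.innerF_le`): a unital Schwarz map `M`
satisfies `⟨M X, M X⟩_{f,σ} ≤ ⟨X, X⟩_{f,E(σ)}`, where `E` is its adjoint. In eigenbases of `σ` and
`E(σ)` both sides are weighted `ℓ²` norms of the matrix entries, with weights `P_f(λ_i, λ_j)`
(`innerF_self`). The Schwarz inequality for `X` and for `X*` says that `M` is a contraction for the
weights `λ_j` and for the weights `λ_i`, so monotonicity is an interpolation theorem for pairs of
weighted `ℓ²` norms (`interpolation`). For positive weights it is Jensen's operator inequality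
for the contraction obtained by rescaling one of the two norms to the standard one; Jensen's
inequality itself follows from operator monotonicity alone, by dilating the contraction to an
isometry `T` and comparing `A` with an operator that acts as a multiple of `B` on the range of `T`
and as a large constant on its complement (`OperatorMonotone.jensen_isometry`). Its scalar case says
that `f(t) / t` is nonincreasing, which gives the limits in the definition of `P_f` and the
continuity of `P_f` along rays that enter the open quadrant, hence the case of singular states by
perturbing all weights.

Data processing follows, since `M` also preserves means and correlations: it takes feasible
observables to observables of mean zero and norm at most `1`. These can be rescaled to feasible ones
unless the norm vanishes, and then the correlation vanishes as well, because the correlation is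
bounded by a constant times the product of the norms (`exists_correlation_bound`); this bound is also
the finiteness of `μ_f`. It holds although `P_f` may vanish on the boundary of the quadrant, because
a state is supported on the tensor product of the supports of its marginals.

Isometric invariance is data processing for `S ↦ V S V*` and for a left inverse of this map. For a
classical state the off-diagonal entries of observables do not contribute to the correlation and only
increase the norm, and `P_f(x, x) = x`; complex functions on the diagonal are reduced to real ones
by a phase.
-/

namespace MaxCorr

/-! ### Functional calculus of Hermitian matrices -/

lemma exists_polynomial_eqOn {s : Set ℝ} (hs : s.Finite) (f : ℝ → ℝ) :
    ∃ q : Polynomial ℝ, ∀ x ∈ s, q.eval x = f x :=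
  ⟨Lagrange.interpolate hs.toFinset id f, fun x hx => by
    simpa using Lagrange.eval_interpolate_at_node f (s := hs.toFinset) (v := id)
      (Function.injective_id.injOn) (by simpa using hx)⟩

lemma cfc_eq_aeval {m : Type*} [Fintype m] [DecidableEq m] {f : ℝ → ℝ} {A : Matrix m m ℂ}
    (hA : A.IsHermitian) {q : Polynomial ℝ} (hq : ∀ x ∈ spectrum ℝ A, q.eval x = f x) :
    cfc f A = Polynomial.aeval A q := by
  rw [← cfc_polynomial q A hA]
  exact (cfc_congr hq).symm

/-- If `T` intertwines two Hermitian matrices then it intertwines any function of them. -/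
lemma cfc_mul_of_intertwine {m n : Type*} [Fintype m] [DecidableEq m] [Fintype n] [DecidableEq n]
    (f : ℝ → ℝ) {A : Matrix m m ℂ} {B : Matrix n n ℂ} {T : Matrix m n ℂ}
    (hA : A.IsHermitian) (hB : B.IsHermitian) (h : A * T = T * B) :
    cfc f A * T = T * cfc f B := by
  obtain ⟨q, hq⟩ := exists_polynomial_eqOn
    ((Matrix.finite_real_spectrum (A := A)).union (Matrix.finite_real_spectrum (A := B))) f
  rw [cfc_eq_aeval hA fun x hx => hq x (Or.inl hx), cfc_eq_aeval hB fun x hx => hq x (Or.inr hx)]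
  clear hq
  induction q using Polynomial.induction_on' with
  | add p q hp hq => simp [Matrix.add_mul, Matrix.mul_add, hp, hq]
  | monomial k c =>
    have hk : A ^ k * T = T * B ^ k := by
      induction k with
      | zero => simp
      | succ k ih => rw [pow_succ, Matrix.mul_assoc, h, ← Matrix.mul_assoc, ih, Matrix.mul_assoc,
          ← pow_succ]
    rw [Polynomial.aeval_monomial, Polynomial.aeval_monomial, Matrix.mul_assoc, hk]
    simp [Algebra.algebraMap_eq_smul_one]

lemma isHermitian_diagonal_ofReal {n : Type*} [DecidableEq n] (d : n → ℝ) :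
    (Matrix.diagonal fun i => (d i : ℂ)).IsHermitian := by
  rw [Matrix.isHermitian_diagonal_iff]
  intro i
  simp [isSelfAdjoint_iff]

lemma cfc_diagonal {n : Type*} [Fintype n] [DecidableEq n] (f : ℝ → ℝ) (d : n → ℝ) :
    cfc f (Matrix.diagonal fun i => (d i : ℂ)) = Matrix.diagonal fun i => (f (d i) : ℂ) := by
  set D : Matrix n n ℂ := Matrix.diagonal fun i => (d i : ℂ)
  obtain ⟨q, hq⟩ := exists_polynomial_eqOn
    ((Matrix.finite_real_spectrum (A := D)).union (Set.finite_range d)) f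
  rw [cfc_eq_aeval (isHermitian_diagonal_ofReal d) fun x hx => hq x (Or.inl hx)]
  have h1 : ∀ i, (f (d i) : ℂ) = ((q.eval (d i) : ℝ) : ℂ) := fun i => by
    rw [hq _ (Or.inr ⟨i, rfl⟩)]
  simp_rw [h1]
  clear hq h1
  induction q using Polynomial.induction_on' with
  | add p q hp hq => simp [hp, hq, Matrix.diagonal_add]
  | monomial k c =>
    rw [Polynomial.aeval_monomial, Matrix.diagonal_pow, Matrix.algebraMap_eq_diagonal,
      Matrix.diagonal_mul_diagonal]
    simp

lemma cfc_unitary_conj {n : Type*} [Fintype n] [DecidableEq n] (f : ℝ → ℝ) (d : n → ℝ)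
    {U : Matrix n n ℂ} (hU : Uᴴ * U = 1) :
    cfc f (U * (Matrix.diagonal fun i => (d i : ℂ)) * Uᴴ) =
      U * (Matrix.diagonal fun i => (f (d i) : ℂ)) * Uᴴ := by
  have hU' : U * Uᴴ = 1 := mul_eq_one_comm.mp hU
  have h := cfc_mul_of_intertwine f (T := U)
    (Matrix.isHermitian_mul_mul_conjTranspose U (isHermitian_diagonal_ofReal d))
    (isHermitian_diagonal_ofReal d) (by rw [Matrix.mul_assoc, hU, Matrix.mul_one])
  rw [cfc_diagonal] at h
  rw [← h, Matrix.mul_assoc (cfc f _) U, hU', Matrix.mul_one]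

/-- Operator monotonicity, transported from `Fin n` to an arbitrary finite index type. -/
lemma OperatorMonotone.cfc_le {f : ℝ → ℝ} (hf : OperatorMonotone f) {n : Type*} [Fintype n]
    [DecidableEq n] {A B : Matrix n n ℂ} (hA : A.PosDef) (hB : B.PosDef)
    (h : (B - A).PosSemidef) : (cfc f B - cfc f A).PosSemidef := by
  let e := (Fintype.equivFin n).symm
  have key : ∀ C : Matrix n n ℂ, C.IsHermitian →
      cfc f (C.submatrix e e) = (cfc f C).submatrix e e := by
    intro C hC
    have hl : ∀ M : Matrix n n ℂ, M * (1 : Matrix n n ℂ).submatrix (Equiv.refl n) e =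
        M.submatrix id e := fun M => by rw [Matrix.mul_submatrix_one]; rfl
    have hr : ∀ M : Matrix (Fin (Fintype.card n)) (Fin (Fintype.card n)) ℂ,
        (1 : Matrix n n ℂ).submatrix (Equiv.refl n) e * M = M.submatrix e.symm id :=
      fun M => by rw [Matrix.one_submatrix_mul]; rfl
    have h1 := cfc_mul_of_intertwine f (A := C) (B := C.submatrix e e)
      (T := (1 : Matrix n n ℂ).submatrix (Equiv.refl n) e) hC (hC.submatrix e) (by
        rw [hl, hr]
        ext i j
        simp)
    rw [hl, hr] at h1
    ext i j
    simpa using (congrFun (congrFun h1 (e i)) j).symm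
  have h1 := hf _ (A.submatrix e e) (B.submatrix e e) (hA.submatrix e.injective)
    (hB.submatrix e.injective) (by
      have := h.submatrix e
      rwa [Matrix.submatrix_sub] at this)
  rw [key _ hA.1, key _ hB.1] at h1
  exact (Matrix.posSemidef_submatrix_equiv e).mp h1

/-! ### Jensen's inequality and the scaling inequality for operator monotone functions -/

lemma star_dotProduct_diagonal_mulVec {l : Type*} [Fintype l] [DecidableEq l] (c : l → ℝ)
    (y : l → ℂ) : star y ⬝ᵥ (Matrix.diagonal (fun i => (c i : ℂ)) *ᵥ y) =
      ((∑ i, c i * ‖y i‖ ^ 2 : ℝ) : ℂ) := by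
  push_cast
  refine Finset.sum_congr rfl fun i _ => ?_
  rw [Matrix.mulVec_diagonal, ← Complex.conj_mul']
  simp only [Pi.star_apply, RCLike.star_def]
  ring

lemma posSemidef_sub_conj_diagonal_iff {m n : Type*} [Fintype m] [DecidableEq m] [Fintype n]
    [DecidableEq n] (d : m → ℝ) (d' : n → ℝ) (V : Matrix m n ℂ) :
    ((Matrix.diagonal fun k => (d' k : ℂ)) -
      Vᴴ * (Matrix.diagonal fun i => (d i : ℂ)) * V).PosSemidef
      ↔ ∀ x : n → ℂ, ∑ i, d i * ‖(V *ᵥ x) i‖ ^ 2 ≤ ∑ k, d' k * ‖x k‖ ^ 2 := by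
  have hq2 : ∀ x : n → ℂ, star x ⬝ᵥ (((Matrix.diagonal fun k => (d' k : ℂ)) -
      Vᴴ * (Matrix.diagonal fun i => (d i : ℂ)) * V) *ᵥ x) =
      ((∑ k, d' k * ‖x k‖ ^ 2 - ∑ i, d i * ‖(V *ᵥ x) i‖ ^ 2 : ℝ) : ℂ) := by
    intro x
    rw [Matrix.sub_mulVec, dotProduct_sub, star_dotProduct_diagonal_mulVec,
      ← Matrix.mulVec_mulVec, ← Matrix.mulVec_mulVec,
      Matrix.dotProduct_mulVec, Matrix.vecMul_conjTranspose, star_star,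
      star_dotProduct_diagonal_mulVec]
    push_cast
    rfl
  constructor
  · intro h x
    have := h.dotProduct_mulVec_nonneg x
    rw [hq2] at this
    have := Complex.zero_le_real.mp this
    linarith
  · intro h
    refine Matrix.PosSemidef.of_dotProduct_mulVec_nonneg ?_ fun x => ?_
    · exact (isHermitian_diagonal_ofReal d').sub
        (Matrix.isHermitian_conjTranspose_mul_mul V (isHermitian_diagonal_ofReal d))
    · rw [hq2]
      exact Complex.zero_le_real.mpr (by linarith [h x])

lemma posDef_diagonal_ofReal {n : Type*} [Fintype n] [DecidableEq n] {d : n → ℝ}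
    (hd : ∀ i, 0 < d i) : (Matrix.diagonal fun i => (d i : ℂ)).PosDef :=
  Matrix.PosDef.diagonal fun i => Complex.zero_lt_real.mpr (hd i)

/-- Compression of `A` by the projection `P`, with complementary projection `Q`, costs only a
factor `1 + ε` and a multiple of `Q`. -/
lemma posSemidef_pinching_sub {n : Type*} [Fintype n] [DecidableEq n] {A P Q : Matrix n n ℂ}
    (hA : A.PosSemidef) (hP : Pᴴ = P) (hQ : Qᴴ = Q) (hPQ : P + Q = 1) {ε : ℝ} (hε : 0 < ε) :
    ((1 + ε) • (P * A * P) + (1 + ε⁻¹) • (Q * A * Q) - A).PosSemidef := by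
  have h1 : (ε⁻¹ • ((ε • P - Q) * A * (ε • P - Q)ᴴ)).PosSemidef :=
    (hA.mul_mul_conjTranspose_same _).smul (by positivity)
  have h2 : A = P * A * P + P * A * Q + Q * A * P + Q * A * Q := by
    calc A = (P + Q) * A * (P + Q) := by simp [hPQ]
      _ = _ := by noncomm_ring
  convert h1 using 1
  rw [Matrix.conjTranspose_sub, Matrix.conjTranspose_smul, hP, hQ, star_trivial]
  conv_lhs => rw [h2]
  have h3 : P * (P * A * P + P * A * Q + Q * A * P + Q * A * Q) * P = P * A * P := by rw [← h2]
  have h4 : Q * (P * A * P + P * A * Q + Q * A * P + Q * A * Q) * Q = Q * A * Q := by rw [← h2]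
  rw [h3, h4]
  simp only [sub_mul, mul_sub, Matrix.smul_mul, Matrix.mul_smul]
  match_scalars <;> field_simp <;> ring

/-- Jensen's operator inequality for an isometry `T`: if `T* A T ≤ B` then
`T* f(A) T ≤ f(r B)` for every `r > 1`. -/
lemma OperatorMonotone.jensen_isometry {f : ℝ → ℝ} (hf : OperatorMonotone f) {m n : Type*}
    [Fintype m] [DecidableEq m] [Fintype n] [DecidableEq n] {A : n → ℝ} {B : m → ℝ}
    (hA : ∀ i, 0 < A i) {T : Matrix n m ℂ} (hT : Tᴴ * T = 1)
    (h : ((Matrix.diagonal fun k => (B k : ℂ)) -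
      Tᴴ * (Matrix.diagonal fun i => (A i : ℂ)) * T).PosSemidef) {r : ℝ} (hr : 1 < r) :
    ((Matrix.diagonal fun k => (f (r * B k) : ℂ)) -
      Tᴴ * (Matrix.diagonal fun i => (f (A i) : ℂ)) * T).PosSemidef := by
  obtain ⟨ε, hε, rfl⟩ : ∃ ε : ℝ, 0 < ε ∧ r = 1 + ε := ⟨r - 1, by linarith, by ring⟩
  obtain ⟨C, hC⟩ : ∃ C : ℝ, ∀ i, (1 + ε⁻¹) * A i ≤ C := by
    obtain ⟨C, hC⟩ := (Set.finite_range fun i => (1 + ε⁻¹) * A i).bddAbove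
    exact ⟨C, fun i => hC ⟨i, rfl⟩⟩
  set DA : Matrix n n ℂ := Matrix.diagonal fun i => (A i : ℂ) with hDA
  set DB : Matrix m m ℂ := Matrix.diagonal fun k => (B k : ℂ) with hDB
  set P : Matrix n n ℂ := T * Tᴴ with hP
  set Q : Matrix n n ℂ := 1 - P with hQ
  have hPT : P * T = T := by rw [hP, Matrix.mul_assoc, hT, Matrix.mul_one]
  have hQT : Q * T = 0 := by rw [hQ, Matrix.sub_mul, hPT, Matrix.one_mul, sub_self]
  have hPP : P * P = P := by rw [hP, ← Matrix.mul_assoc, ← hP, hPT]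
  have hQQ : Q * Q = Q := by
    rw [hQ, Matrix.mul_sub, Matrix.sub_mul, Matrix.sub_mul, hPP]
    simp
  have hPh : Pᴴ = P := by simp [hP]
  have hQh : Qᴴ = Q := by simp [hQ, hPh]
  clear_value Q
  -- the operator `r B` on the range of `T` and `C` on its complement dominates `A`
  set Bt : Matrix n n ℂ := (1 + ε) • (T * DB * Tᴴ) + C • Q with hBt
  have hle : (Bt - DA).PosSemidef := by
    have h1 := posSemidef_pinching_sub (posDef_diagonal_ofReal hA).posSemidef hPh hQh
      (by simp [hQ]) hε
    have h2 : ((1 + ε) • (T * (DB - Tᴴ * DA * T) * Tᴴ)).PosSemidef :=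
      (h.mul_mul_conjTranspose_same T).smul (by positivity)
    have h3 : (Q * (C • 1 - (1 + ε⁻¹) • DA) * Qᴴ).PosSemidef := by
      refine Matrix.PosSemidef.mul_mul_conjTranspose_same ?_ Q
      have : C • 1 - (1 + ε⁻¹) • DA =
          Matrix.diagonal fun i => ((C - (1 + ε⁻¹) * A i : ℝ) : ℂ) := by
        ext i j
        by_cases hij : i = j <;> simp [hDA, hij]
      rw [this, Matrix.posSemidef_diagonal_iff]
      intro i
      exact Complex.zero_le_real.mpr (by linarith [hC i])
    convert (h1.add h2).add h3 using 1
    have e1 : T * (DB - Tᴴ * DA * T) * Tᴴ = T * DB * Tᴴ - P * DA * P := by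
      simp only [Matrix.mul_sub, Matrix.sub_mul, hP, Matrix.mul_assoc]
    have e2 : Q * (C • 1 - (1 + ε⁻¹) • DA) * Qᴴ = C • Q - (1 + ε⁻¹) • (Q * DA * Q) := by
      rw [hQh, Matrix.mul_sub, Matrix.sub_mul]
      simp [hQQ]
    rw [e1, e2, hBt]
    module
  have hDAp : DA.PosDef := posDef_diagonal_ofReal hA
  have hBtp : Bt.PosDef := by
    have := hDAp.add_posSemidef hle
    rwa [add_sub_cancel] at this
  have key := hf.cfc_le hDAp hBtp hle
  have hcomm : Bt * T = T * (Matrix.diagonal fun k => (((1 + ε) * B k : ℝ) : ℂ)) := by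
    rw [hBt, Matrix.add_mul, Matrix.smul_mul, Matrix.smul_mul, hQT, Matrix.mul_assoc,
      Matrix.mul_assoc, hT, Matrix.mul_one, smul_zero, add_zero, ← Matrix.mul_smul]
    congr 1
    ext i j
    by_cases hij : i = j <;> simp [hDB, hij]
  have h4 := cfc_mul_of_intertwine f hBtp.1 (isHermitian_diagonal_ofReal _) hcomm
  rw [cfc_diagonal] at h4
  have h5 := key.conjTranspose_mul_mul_same T
  rwa [Matrix.mul_sub, Matrix.sub_mul, Matrix.mul_assoc Tᴴ (cfc f Bt), h4, ← Matrix.mul_assoc, hT,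
    Matrix.one_mul, hDA, cfc_diagonal] at h5

/-- Jensen's operator inequality for a contraction `V`, in terms of quadratic forms: if
`V* A V ≤ B` then `V* f(A) V ≤ f(r B)` for every `r > 1`. -/
lemma NormalizedOperatorMonotone.jensen_contraction {f : ℝ → ℝ}
    (hf : NormalizedOperatorMonotone f) {m n : Type*}
    [Fintype m] [DecidableEq m] [Fintype n] [DecidableEq n] {A : n → ℝ} {B : m → ℝ}
    (hA : ∀ i, 0 < A i) (hB : ∀ i, 0 < B i) {V : Matrix n m ℂ}
    (hV : ∀ x : m → ℂ, ∑ i, ‖(V *ᵥ x) i‖ ^ 2 ≤ ∑ k, ‖x k‖ ^ 2)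
    (h : ∀ x : m → ℂ, ∑ i, A i * ‖(V *ᵥ x) i‖ ^ 2 ≤ ∑ k, B k * ‖x k‖ ^ 2)
    {r : ℝ} (hr : 1 < r) (x : m → ℂ) :
    ∑ i, f (A i) * ‖(V *ᵥ x) i‖ ^ 2 ≤ ∑ k, f (r * B k) * ‖x k‖ ^ 2 := by
  -- complete `V` to an isometry with a block `D` such that `D* D = 1 - V* V`
  obtain ⟨D, hD⟩ : ∃ D : Matrix m m ℂ, 1 - Vᴴ * V = Dᴴ * D := by
    have := (posSemidef_sub_conj_diagonal_iff (fun _ => 1) (fun _ => 1) V).mpr (by simpa using hV)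
    simp only [Complex.ofReal_one, Matrix.diagonal_one, Matrix.mul_one] at this
    open scoped MatrixOrder in
    exact CStarAlgebra.nonneg_iff_eq_star_mul_self.mp this.nonneg
  set T : Matrix (n ⊕ m) m ℂ := Matrix.fromRows V D with hTdef
  have hTx : ∀ (y : m → ℂ), T *ᵥ y = Sum.elim (V *ᵥ y) (D *ᵥ y) := fun y =>
    Matrix.fromRows_mulVec _ _ _
  have hT : Tᴴ * T = 1 := by
    rw [hTdef, Matrix.conjTranspose_fromRows_eq_fromCols_conjTranspose,
      Matrix.fromCols_mul_fromRows, ← hD]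
    simp
  have hDx : ∀ y : m → ℂ, ∑ i, ‖(D *ᵥ y) i‖ ^ 2 ≤ ∑ k, ‖y k‖ ^ 2 := by
    intro y
    have h1 := (posSemidef_sub_conj_diagonal_iff (fun _ => 1) (fun _ => 1) D).mp (by
      simp only [Complex.ofReal_one, Matrix.diagonal_one, Matrix.mul_one, ← hD, sub_sub_cancel]
      exact Matrix.posSemidef_conjTranspose_mul_self V) y
    simpa using h1
  set s := √r with hs
  have hs1 : 1 < s := by rw [hs]; exact Real.lt_sqrt_of_sq_lt (by simpa)
  have hss : s * s = r := Real.mul_self_sqrt (by linarith)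
  -- the weight on the added coordinates, small enough to be absorbed in `s B`
  obtain ⟨δ, hδ, hδB⟩ : ∃ δ : ℝ, 0 < δ ∧ ∀ k, δ ≤ (s - 1) * B k := by
    rcases isEmpty_or_nonempty m with hm | hm
    · exact ⟨1, one_pos, fun k => hm.elim k⟩
    · obtain ⟨k₀, hk₀⟩ := Finite.exists_min B
      exact ⟨(s - 1) * B k₀, mul_pos (by linarith) (hB _), fun k =>
        mul_le_mul_of_nonneg_left (hk₀ k) (by linarith)⟩
  have key := hf.monotone.jensen_isometry (A := Sum.elim A fun _ => δ) (B := fun k => s * B k)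
    (by rintro (i | i) <;> simp [hA, hδ]) hT (by
      rw [posSemidef_sub_conj_diagonal_iff]
      intro y
      simp only [hTx, Fintype.sum_sum_type, Sum.elim_inl, Sum.elim_inr]
      calc _ ≤ ∑ k, B k * ‖y k‖ ^ 2 + ∑ k, (s - 1) * B k * ‖y k‖ ^ 2 := by
            refine add_le_add (h y) ?_
            rw [← Finset.mul_sum]
            calc _ ≤ δ * ∑ k, ‖y k‖ ^ 2 := mul_le_mul_of_nonneg_left (hDx y) hδ.le
              _ ≤ _ := by
                rw [Finset.mul_sum]
                exact Finset.sum_le_sum fun k _ =>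
                  mul_le_mul_of_nonneg_right (hδB k) (by positivity)
        _ = _ := by
            rw [← Finset.sum_add_distrib]
            exact Finset.sum_congr rfl fun k _ => by ring) hs1
  rw [posSemidef_sub_conj_diagonal_iff (fun i => f (Sum.elim A (fun _ => δ) i))
    (fun k => f (s * (s * B k)))] at key
  have := key x
  simp only [hTx, Fintype.sum_sum_type, Sum.elim_inl, Sum.elim_inr, ← mul_assoc, hss] at this
  refine le_trans (le_add_of_nonneg_right ?_) this
  exact Finset.sum_nonneg fun i _ => mul_nonneg (hf.nonneg _ hδ) (by positivity)

/-- Jensen's inequality for the scalar contraction `√s`; the slack between `s` and `c` absorbs the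
factor `r > 1`. -/
lemma NormalizedOperatorMonotone.mul_le_of_lt {f : ℝ → ℝ} (hf : NormalizedOperatorMonotone f)
    {s c x : ℝ} (hs : 0 < s) (hs1 : s ≤ 1) (hsc : s < c) (hx : 0 < x) :
    s * f x ≤ f (c * x) := by
  have h := hf.jensen_contraction (m := Unit) (n := Unit) (A := fun _ => x) (B := fun _ => s * x)
    (fun _ => hx) (fun _ => by positivity) (V := fun _ _ => (√s : ℂ))
    (by
      intro y
      simp only [Matrix.mulVec, dotProduct, Finset.univ_unique, Finset.sum_singleton, norm_mul,
        mul_pow, Complex.norm_real, Real.norm_eq_abs, sq_abs, Real.sq_sqrt hs.le]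
      exact mul_le_of_le_one_left (by positivity) hs1)
    (by
      intro y
      simp only [Matrix.mulVec, dotProduct, Finset.univ_unique, Finset.sum_singleton, norm_mul,
        mul_pow, Complex.norm_real, Real.norm_eq_abs, sq_abs, Real.sq_sqrt hs.le]
      exact le_of_eq (by ring))
    (r := c / s) (by rwa [one_lt_div hs]) (fun _ => 1)
  simp only [Matrix.mulVec, dotProduct, Finset.univ_unique, Finset.sum_singleton, norm_mul,
    mul_pow, Complex.norm_real, Real.norm_eq_abs, sq_abs, Real.sq_sqrt hs.le] at h
  have e : c / s * (s * x) = c * x := by field_simp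
  rw [e] at h
  simpa [mul_comm] using h

lemma NormalizedOperatorMonotone.map_mul_le {f : ℝ → ℝ} (hf : NormalizedOperatorMonotone f)
    {t x : ℝ} (ht : 1 ≤ t) (hx : 0 < x) : f (t * x) ≤ t * f x := by
  have ht0 : 0 < t := by linarith
  have h : t⁻¹ * f (t * x) ≤ f x := by
    by_contra! hlt
    have hfx := hf.nonneg x hx
    have hF : 0 < f (t * x) := by
      by_contra! hF
      have := mul_nonpos_of_nonneg_of_nonpos (inv_nonneg.mpr ht0.le) hF
      linarith
    obtain ⟨s, hs1, hs2⟩ := exists_between ((div_lt_iff₀ hF).mpr hlt)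
    have hs0 : 0 < s := (div_nonneg hfx hF.le).trans_lt hs1
    have := hf.mul_le_of_lt hs0 (hs2.le.trans (inv_le_one_of_one_le₀ ht)) hs2
      (mul_pos ht0 hx)
    rw [inv_mul_cancel_left₀ ht0.ne'] at this
    rw [div_lt_iff₀ hF] at hs1
    linarith
  rwa [inv_mul_le_iff₀ ht0] at h

lemma NormalizedOperatorMonotone.mono {f : ℝ → ℝ} (hf : NormalizedOperatorMonotone f)
    {x y : ℝ} (hx : 0 < x) (hxy : x ≤ y) : f x ≤ f y := by
  rcases hxy.eq_or_lt with rfl | hlt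
  · rfl
  · have := hf.mul_le_of_lt one_pos le_rfl (c := y / x) (by rwa [one_lt_div hx]) hx
    rwa [div_mul_cancel₀ _ hx.ne', one_mul] at this

/-! ### Limits of the perspective -/

open Filter

section Perspective

variable {f : ℝ → ℝ} (hf : NormalizedOperatorMonotone f)
include hf

lemma NormalizedOperatorMonotone.pos {x : ℝ} (hx : 0 < x) : 0 < f x := by
  rcases le_total 1 x with h | h
  · have := hf.mono one_pos h
    rw [hf.normalized] at this
    linarith
  · have h1 := hf.map_mul_le ((one_le_inv₀ hx).mpr h) hx
    rw [inv_mul_cancel₀ hx.ne', hf.normalized, ← div_eq_inv_mul, le_div_iff₀ hx] at h1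
    linarith

lemma NormalizedOperatorMonotone.continuousAt {x : ℝ} (hx : 0 < x) : ContinuousAt f x := by
  have hlow : Tendsto (fun y : ℝ => min 1 (y / x) * f x) (𝓝 x) (𝓝 (f x)) := by
    have : ContinuousAt (fun y : ℝ => min 1 (y / x) * f x) x := by fun_prop
    simpa [ContinuousAt, div_self hx.ne'] using this
  have hhigh : Tendsto (fun y : ℝ => max 1 (y / x) * f x) (𝓝 x) (𝓝 (f x)) := by
    have : ContinuousAt (fun y : ℝ => max 1 (y / x) * f x) x := by fun_prop
    simpa [ContinuousAt, div_self hx.ne'] using this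
  have hfx := (hf.pos hx).le
  refine tendsto_of_tendsto_of_tendsto_of_le_of_le' hlow hhigh ?_ ?_
  · filter_upwards [lt_mem_nhds hx] with y hy
    rcases le_total x y with h | h
    · exact (mul_le_of_le_one_left hfx (min_le_left _ _)).trans (hf.mono hx h)
    · have h1 := hf.map_mul_le ((one_le_div hy).mpr h) hy
      rw [div_mul_cancel₀ _ hy.ne', div_mul_eq_mul_div, le_div_iff₀ hy] at h1
      refine (mul_le_mul_of_nonneg_right (min_le_right _ _) hfx).trans ?_
      rw [div_mul_eq_mul_div, div_le_iff₀ hx]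
      linarith
  · filter_upwards [lt_mem_nhds hx] with y hy
    rcases le_total x y with h | h
    · have h1 := hf.map_mul_le ((one_le_div hx).mpr h) hx
      rw [div_mul_cancel₀ _ hx.ne'] at h1
      exact h1.trans (mul_le_mul_of_nonneg_right (le_max_right _ _) hfx)
    · exact (hf.mono hy h).trans (le_mul_of_one_le_left hfx (le_max_left _ _))

lemma NormalizedOperatorMonotone.tendsto_zero :
    Tendsto f (𝓝[>] 0) (𝓝 (limUnder (𝓝[>] (0 : ℝ)) f)) := by
  have hmono : MonotoneOn f (Set.Ioi 0) := fun x hx y _ hxy => hf.mono hx hxy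
  have hbdd : BddBelow (f '' Set.Ioi 0) := ⟨0, by
    rintro _ ⟨x, hx, rfl⟩
    exact hf.nonneg x hx⟩
  have := hmono.tendsto_nhdsGT hbdd
  rwa [this.limUnder_eq]

lemma NormalizedOperatorMonotone.tendsto_div_atTop :
    Tendsto (fun t : ℝ => f t / t) atTop (𝓝 (limUnder atTop fun t : ℝ => f t / t)) := by
  have hanti : Antitone fun t : ℝ => f (max t 1) / max t 1 := by
    intro s t hst
    have hs : 0 < max s 1 := by positivity
    have ht : 0 < max t 1 := by positivity
    have hle : max s 1 ≤ max t 1 := max_le_max_right 1 hst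
    have h1 := hf.map_mul_le ((one_le_div hs).mpr hle) hs
    rw [div_mul_cancel₀ _ hs.ne', div_mul_eq_mul_div, le_div_iff₀ hs] at h1
    change f (max t 1) / max t 1 ≤ f (max s 1) / max s 1
    rw [div_le_div_iff₀ ht hs]
    linarith
  have hbdd : BddBelow (Set.range fun t : ℝ => f (max t 1) / max t 1) := ⟨0, by
    rintro _ ⟨t, rfl⟩
    have ht : 0 < max t 1 := by positivity
    exact div_nonneg (hf.nonneg _ ht) ht.le⟩
  have h := tendsto_atTop_ciInf hanti hbdd
  have h' := h.congr' (f₂ := fun t : ℝ => f t / t) (by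
    filter_upwards [eventually_ge_atTop 1] with t ht
    rw [max_eq_left ht])
  rwa [h'.limUnder_eq]

omit hf in
lemma perspective_of_pos {x y : ℝ} (hx : 0 < x) (hy : 0 < y) :
    perspective f x y = y * f (x / y) := by
  simp [perspective, hx, hy]

lemma perspective_pos {x y : ℝ} (hx : 0 < x) (hy : 0 < y) : 0 < perspective f x y := by
  rw [perspective_of_pos hx hy]
  exact mul_pos hy (hf.pos (div_pos hx hy))

lemma perspective_self {x : ℝ} (hx : 0 ≤ x) : perspective f x x = x := by
  rcases hx.eq_or_lt with rfl | h
  · simp [perspective]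
  · rw [perspective_of_pos h h, div_self h.ne', hf.normalized, mul_one]

/-- The perspective is continuous along the rays `ε ↦ (x + c ε, y + c ε)`, also at the boundary of
the quadrant. -/
lemma tendsto_perspective {x y c : ℝ} (hx : 0 ≤ x) (hy : 0 ≤ y) (hc : 0 < c) :
    Tendsto (fun ε : ℝ => perspective f (x + c * ε) (y + c * ε)) (𝓝[>] 0)
      (𝓝 (perspective f x y)) := by
  have hcε : ∀ ε : ℝ, 0 < ε → 0 < c * ε := fun ε h => mul_pos hc h
  have hlin : ∀ z : ℝ, Tendsto (fun ε : ℝ => z + c * ε) (𝓝[>] 0) (𝓝 z) := fun z => by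
    have : ContinuousAt (fun ε : ℝ => z + c * ε) 0 := by fun_prop
    have h2 := this.tendsto
    simp only [mul_zero, add_zero] at h2
    exact h2.mono_left nhdsWithin_le_nhds
  have hcongr : (fun ε : ℝ => perspective f (x + c * ε) (y + c * ε)) =ᶠ[𝓝[>] 0]
      fun ε => (y + c * ε) * f ((x + c * ε) / (y + c * ε)) := by
    filter_upwards [self_mem_nhdsWithin] with ε hε
    have := hcε ε hε
    exact perspective_of_pos (by linarith) (by linarith)
  refine Tendsto.congr' hcongr.symm ?_
  rcases hy.eq_or_lt with rfl | hy'
  · rcases hx.eq_or_lt with rfl | hx'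
    · -- both arguments vanish
      rw [perspective_self hf le_rfl]
      refine (hlin 0).congr' ?_
      filter_upwards [self_mem_nhdsWithin] with ε hε
      have := hcε ε hε
      rw [zero_add, div_self this.ne', hf.normalized, mul_one]
    · -- `y = 0 < x`: the ratio tends to infinity
      have hP : perspective f x 0 = x * limUnder atTop (fun t : ℝ => f t / t) := by
        simp [perspective, hx'.ne']
      rw [hP]
      have hinv : Tendsto (fun ε : ℝ => (x + c * ε) / (0 + c * ε)) (𝓝[>] 0) atTop := by
        refine Tendsto.pos_mul_atTop hx' (hlin x) ?_
        refine Tendsto.comp tendsto_inv_nhdsGT_zero ?_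
        refine tendsto_nhdsWithin_iff.mpr ⟨hlin 0, ?_⟩
        filter_upwards [self_mem_nhdsWithin] with ε hε
        simpa using hcε ε hε
      refine ((hlin x).mul (hf.tendsto_div_atTop.comp hinv)).congr' ?_
      filter_upwards [self_mem_nhdsWithin] with ε hε
      have h1 := hcε ε hε
      have h2 : 0 < x + c * ε := by linarith
      simp only [Function.comp, zero_add]
      field_simp
  · rcases hx.eq_or_lt with rfl | hx'
    · -- `x = 0 < y`: the ratio tends to zero
      have hP : perspective f 0 y = y * limUnder (𝓝[>] (0 : ℝ)) f := by
        simp [perspective]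
      rw [hP]
      refine (hlin y).mul (hf.tendsto_zero.comp ?_)
      refine tendsto_nhdsWithin_iff.mpr ⟨?_, ?_⟩
      · have h1 := (hlin 0).div (hlin y) hy'.ne'
        rwa [zero_div] at h1
      · filter_upwards [self_mem_nhdsWithin] with ε hε
        have := hcε ε hε
        exact div_pos (by linarith : 0 < 0 + c * ε) (by linarith : 0 < y + c * ε)
    · rw [perspective_of_pos hx' hy']
      exact (hlin y).mul ((hf.continuousAt (div_pos hx' hy')).tendsto.comp
        ((hlin x).div (hlin y) hy'.ne'))

lemma perspective_nonneg {x y : ℝ} (hx : 0 ≤ x) (hy : 0 ≤ y) : 0 ≤ perspective f x y := by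
  refine ge_of_tendsto (tendsto_perspective hf hx hy one_pos) ?_
  filter_upwards [self_mem_nhdsWithin] with ε hε
  have : (0 : ℝ) < ε := hε
  exact (perspective_pos hf (by linarith) (by linarith)).le

/-! ### Interpolation of quadratic forms -/

/-- Interpolation between two weighted `ℓ²` norms, for positive weights: if `L` is a contraction
for the weights `q, q'` and for the weights `p, p'`, it is a contraction for the weights
`P_f(p, q), P_f(p', q')`. -/
lemma interpolation_of_pos {ι κ : Type*} [Fintype ι] [DecidableEq ι] [Fintype κ] [DecidableEq κ]
    {p q : ι → ℝ} {p' q' : κ → ℝ} (hp : ∀ i, 0 < p i) (hq : ∀ i, 0 < q i) (hp' : ∀ k, 0 < p' k)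
    (hq' : ∀ k, 0 < q' k) (L : Matrix ι κ ℂ)
    (h1 : ∀ x : κ → ℂ, ∑ i, q i * ‖(L *ᵥ x) i‖ ^ 2 ≤ ∑ k, q' k * ‖x k‖ ^ 2)
    (h2 : ∀ x : κ → ℂ, ∑ i, p i * ‖(L *ᵥ x) i‖ ^ 2 ≤ ∑ k, p' k * ‖x k‖ ^ 2) (x : κ → ℂ) :
    ∑ i, perspective f (p i) (q i) * ‖(L *ᵥ x) i‖ ^ 2 ≤
      ∑ k, perspective f (p' k) (q' k) * ‖x k‖ ^ 2 := by
  -- rescale both sides so that the weights `q, q'` become `1`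
  set V : Matrix ι κ ℂ := Matrix.of fun i k => (√(q i) : ℂ) * L i k * ((√(q' k))⁻¹ : ℝ) with hVdef
  have hsq : ∀ i, √(q i) ^ 2 = q i := fun i => Real.sq_sqrt (hq i).le
  have hsq' : ∀ k, √(q' k) ^ 2 = q' k := fun k => Real.sq_sqrt (hq' k).le
  have hV : ∀ (y : κ → ℂ) i, ‖(V *ᵥ y) i‖ ^ 2 =
      q i * ‖(L *ᵥ fun k => ((√(q' k))⁻¹ : ℝ) * y k) i‖ ^ 2 := by
    intro y i
    have : (V *ᵥ y) i = (√(q i) : ℂ) * (L *ᵥ fun k => ((√(q' k))⁻¹ : ℝ) * y k) i := by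
      simp only [hVdef, Matrix.mulVec, dotProduct, Finset.mul_sum, Matrix.of_apply, mul_assoc]
    rw [this, norm_mul, mul_pow, Complex.norm_real, Real.norm_eq_abs, sq_abs, hsq]
  have hy : ∀ (y : κ → ℂ) k, ‖((√(q' k))⁻¹ : ℝ) * y k‖ ^ 2 = (q' k)⁻¹ * ‖y k‖ ^ 2 := by
    intro y k
    rw [norm_mul, mul_pow, Complex.norm_real, Real.norm_eq_abs, sq_abs, inv_pow, hsq']
  have key : ∀ r : ℝ, 1 < r →
      ∑ i, perspective f (p i) (q i) * ‖(L *ᵥ x) i‖ ^ 2 ≤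
        r * ∑ k, perspective f (p' k) (q' k) * ‖x k‖ ^ 2 := by
    intro r hr
    have hJ := hf.jensen_contraction (A := fun i => p i / q i) (B := fun k => p' k / q' k)
      (fun i => div_pos (hp i) (hq i)) (fun k => div_pos (hp' k) (hq' k)) (V := V)
      (fun y => by
        simp only [hV]
        refine (h1 _).trans (le_of_eq (Finset.sum_congr rfl fun k _ => ?_))
        rw [hy, mul_inv_cancel_left₀ (hq' k).ne'])
      (fun y => by
        simp only [hV, ← mul_assoc, div_mul_cancel₀ _ (hq _).ne']
        refine (h2 _).trans (le_of_eq (Finset.sum_congr rfl fun k _ => ?_))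
        rw [hy, ← mul_assoc, div_eq_mul_inv])
      hr (fun k => (√(q' k) : ℂ) * x k)
    have hx : (fun k => (((√(q' k))⁻¹ : ℝ) : ℂ) * ((√(q' k) : ℂ) * x k)) = x := by
      funext k
      rw [← mul_assoc, ← Complex.ofReal_mul, inv_mul_cancel₀ (Real.sqrt_pos.mpr (hq' k)).ne']
      simp
    simp only [hV, hx] at hJ
    calc _ = ∑ i, f (p i / q i) * (q i * ‖(L *ᵥ x) i‖ ^ 2) :=
          Finset.sum_congr rfl fun i _ => by rw [perspective_of_pos (hp i) (hq i)]; ring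
      _ ≤ _ := hJ
      _ ≤ _ := by
          rw [Finset.mul_sum]
          refine Finset.sum_le_sum fun k _ => ?_
          rw [norm_mul, mul_pow, Complex.norm_real, Real.norm_eq_abs, sq_abs, hsq',
            perspective_of_pos (hp' k) (hq' k)]
          calc _ ≤ r * f (p' k / q' k) * (q' k * ‖x k‖ ^ 2) :=
                mul_le_mul_of_nonneg_right (hf.map_mul_le hr.le (div_pos (hp' k) (hq' k)))
                  (mul_nonneg (hq' k).le (by positivity))
            _ = _ := by ring
  have hlim : Tendsto (fun r : ℝ => r * ∑ k, perspective f (p' k) (q' k) * ‖x k‖ ^ 2) (𝓝[>] 1)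
      (𝓝 (1 * ∑ k, perspective f (p' k) (q' k) * ‖x k‖ ^ 2)) :=
    (tendsto_id.mono_left nhdsWithin_le_nhds).mul_const _
  rw [one_mul] at hlim
  exact ge_of_tendsto hlim (by filter_upwards [self_mem_nhdsWithin] with r hr using key r hr)

/-- Interpolation between two weighted `ℓ²` seminorms, for nonnegative weights. -/
lemma interpolation {ι κ : Type*} [Fintype ι] [DecidableEq ι] [Fintype κ] [DecidableEq κ]
    {p q : ι → ℝ} {p' q' : κ → ℝ} (hp : ∀ i, 0 ≤ p i) (hq : ∀ i, 0 ≤ q i) (hp' : ∀ k, 0 ≤ p' k)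
    (hq' : ∀ k, 0 ≤ q' k) (L : Matrix ι κ ℂ)
    (h1 : ∀ x : κ → ℂ, ∑ i, q i * ‖(L *ᵥ x) i‖ ^ 2 ≤ ∑ k, q' k * ‖x k‖ ^ 2)
    (h2 : ∀ x : κ → ℂ, ∑ i, p i * ‖(L *ᵥ x) i‖ ^ 2 ≤ ∑ k, p' k * ‖x k‖ ^ 2) (x : κ → ℂ) :
    ∑ i, perspective f (p i) (q i) * ‖(L *ᵥ x) i‖ ^ 2 ≤
      ∑ k, perspective f (p' k) (q' k) * ‖x k‖ ^ 2 := by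
  -- a bound for the unweighted norm of `L`, from Cauchy–Schwarz row by row
  obtain ⟨C, hC, hL⟩ : ∃ C : ℝ, 0 < C ∧ ∀ y : κ → ℂ, ∑ i, ‖(L *ᵥ y) i‖ ^ 2 ≤
      C * ∑ k, ‖y k‖ ^ 2 := by
    refine ⟨∑ i, ∑ k, ‖L i k‖ ^ 2 + 1, by positivity, fun y => ?_⟩
    have hy : 0 ≤ ∑ k, ‖y k‖ ^ 2 := by positivity
    calc _ ≤ ∑ i, (∑ k, ‖L i k‖ ^ 2) * ∑ k, ‖y k‖ ^ 2 := by
          refine Finset.sum_le_sum fun i _ => ?_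
          have h3 : ‖(L *ᵥ y) i‖ ≤ ∑ k, ‖L i k‖ * ‖y k‖ :=
            (norm_sum_le _ _).trans (le_of_eq (by simp))
          exact (pow_le_pow_left₀ (norm_nonneg _) h3 2).trans
            (Finset.sum_mul_sq_le_sq_mul_sq _ _ _)
      _ ≤ _ := by
          rw [← Finset.sum_mul]
          nlinarith
  have key : ∀ ε : ℝ, 0 < ε →
      ∑ i, perspective f (p i + 1 * ε) (q i + 1 * ε) * ‖(L *ᵥ x) i‖ ^ 2 ≤
        ∑ k, perspective f (p' k + C * ε) (q' k + C * ε) * ‖x k‖ ^ 2 := by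
    intro ε hε
    have hCε := mul_pos hC hε
    have hpert : ∀ {u : ι → ℝ} {u' : κ → ℝ},
        (∀ y : κ → ℂ, ∑ i, u i * ‖(L *ᵥ y) i‖ ^ 2 ≤ ∑ k, u' k * ‖y k‖ ^ 2) → ∀ y : κ → ℂ,
        ∑ i, (u i + 1 * ε) * ‖(L *ᵥ y) i‖ ^ 2 ≤ ∑ k, (u' k + C * ε) * ‖y k‖ ^ 2 := by
      intro u u' h y
      simp only [add_mul, Finset.sum_add_distrib, one_mul, ← Finset.mul_sum]
      have := mul_le_mul_of_nonneg_left (hL y) hε.le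
      linarith [h y]
    exact interpolation_of_pos hf (fun i => by linarith [hp i]) (fun i => by linarith [hq i])
      (fun k => by linarith [hp' k]) (fun k => by linarith [hq' k]) L (hpert h1) (hpert h2) x
  refine le_of_tendsto_of_tendsto (b := 𝓝[>] (0 : ℝ))
    (tendsto_finsetSum _ fun i _ =>
      (tendsto_perspective hf (hp i) (hq i) one_pos).mul_const _)
    (tendsto_finsetSum _ fun k _ =>
      (tendsto_perspective hf (hp' k) (hq' k) hC).mul_const _) ?_
  filter_upwards [self_mem_nhdsWithin] with ε hε using key ε hε

end Perspective

/-! ### The form `⟨X, Y⟩_{f,σ}` in an eigenbasis -/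

lemma exists_diagonalization {a : Type*} [Fintype a] [DecidableEq a] {σ : Matrix a a ℂ}
    (hσ : σ.PosSemidef) : ∃ (U : Matrix a a ℂ) (d : a → ℝ), Uᴴ * U = 1 ∧ (∀ i, 0 ≤ d i) ∧
      σ = U * (Matrix.diagonal fun i => (d i : ℂ)) * Uᴴ := by
  refine ⟨hσ.1.eigenvectorUnitary, hσ.1.eigenvalues, ?_, hσ.eigenvalues_nonneg, ?_⟩
  · exact Unitary.coe_star_mul_self _
  · conv_lhs => rw [hσ.1.spectral_theorem, Unitary.conjStarAlgAut_apply]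
    rfl

section Eigenbasis

variable {a : Type*} [Fintype a] [DecidableEq a] {σ U : Matrix a a ℂ} {d : a → ℝ}
  (hU : Uᴴ * U = 1) (hσ : σ = U * (Matrix.diagonal fun i => (d i : ℂ)) * Uᴴ)
include hU hσ

lemma mem_spectrum_of_diagonalization (i : a) : d i ∈ spectrum ℝ σ := by
  have hU' : U * Uᴴ = 1 := mul_eq_one_comm.mp hU
  let u : unitary (Matrix a a ℂ) := ⟨U, hU, hU'⟩
  have h1 : spectrum ℂ σ = Set.range fun i => (d i : ℂ) := by
    have : σ = (u : Matrix a a ℂ) * (Matrix.diagonal fun i => (d i : ℂ)) *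
        star (u : Matrix a a ℂ) := hσ
    rw [this, Unitary.spectrum_star_right_conjugate, spectrum_diagonal]
  exact spectrum.of_algebraMap_mem ℂ (by rw [h1]; exact ⟨i, rfl⟩)

lemma J_eq (f : ℝ → ℝ) (X : Matrix a a ℂ) :
    J f σ X = U * (Matrix.of fun i j => (perspective f (d i) (d j) : ℂ) * (Uᴴ * X * U) i j) *
      Uᴴ := by
  have hQ : ∀ l, spectralProj σ l =
      U * (Matrix.diagonal fun i => (((if d i = l then 1 else 0 : ℝ)) : ℂ)) * Uᴴ := by
    intro l
    rw [spectralProj, hσ, cfc_unitary_conj _ d hU]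
  have hmem : ∀ i, d i ∈ (Matrix.finite_real_spectrum (A := σ)).toFinset := fun i => by
    simpa using mem_spectrum_of_diagonalization hU hσ i
  rw [J]
  simp only [hQ]
  set S := (Matrix.finite_real_spectrum (A := σ)).toFinset
  have h1 : ∀ l m : ℝ, U * (Matrix.diagonal fun i => (((if d i = l then 1 else 0 : ℝ)) : ℂ)) * Uᴴ *
      X * (U * (Matrix.diagonal fun i => (((if d i = m then 1 else 0 : ℝ)) : ℂ)) * Uᴴ) =
      U * ((Matrix.diagonal fun i => (((if d i = l then 1 else 0 : ℝ)) : ℂ)) * (Uᴴ * X * U) *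
        (Matrix.diagonal fun i => (((if d i = m then 1 else 0 : ℝ)) : ℂ))) * Uᴴ := by
    intro l m
    simp only [Matrix.mul_assoc]
  simp only [h1]
  have h2 : ∀ (c : ℂ) (Z : Matrix a a ℂ), c • (U * Z * Uᴴ) = U * (c • Z) * Uᴴ := fun c Z => by
    rw [Matrix.mul_smul, Matrix.smul_mul]
  simp only [h2, ← Matrix.sum_mul, ← Matrix.mul_sum]
  congr 2
  ext i j
  simp only [Matrix.sum_apply, Matrix.smul_apply, Matrix.mul_diagonal, Matrix.diagonal_mul,
    Matrix.of_apply, smul_eq_mul]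
  rw [Finset.sum_eq_single_of_mem (d i) (hmem i), Finset.sum_eq_single_of_mem (d j) (hmem j)]
  · simp
  · intro m _ hm
    simp [hm.symm]
  · intro l _ hl
    simp [hl.symm]

lemma innerF_eq (f : ℝ → ℝ) (X Y : Matrix a a ℂ) :
    innerF f σ X Y = ∑ i, ∑ j, (perspective f (d i) (d j) : ℂ) *
      (star ((Uᴴ * X * U) i j) * (Uᴴ * Y * U) i j) := by
  rw [innerF, J_eq hU hσ, ← Matrix.mul_assoc, ← Matrix.mul_assoc, Matrix.trace_mul_comm,
    ← Matrix.mul_assoc, ← Matrix.mul_assoc]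
  have : Uᴴ * Xᴴ * U = (Uᴴ * X * U)ᴴ := by simp [Matrix.mul_assoc]
  rw [this, Matrix.trace]
  simp only [Matrix.diag_apply, Matrix.mul_apply (M := (Uᴴ * X * U)ᴴ), Matrix.conjTranspose_apply,
    Matrix.of_apply]
  rw [Finset.sum_comm]
  exact Finset.sum_congr rfl fun i _ => Finset.sum_congr rfl fun j _ => by ring

lemma innerF_self (f : ℝ → ℝ) (X : Matrix a a ℂ) :
    innerF f σ X X = ((∑ i, ∑ j, perspective f (d i) (d j) * ‖(Uᴴ * X * U) i j‖ ^ 2 : ℝ) : ℂ) := by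
  rw [innerF_eq hU hσ]
  push_cast
  simp only [← Complex.conj_mul']
  rfl

lemma trace_mul_conjTranspose_mul_self (X : Matrix a a ℂ) :
    (σ * (Xᴴ * X)).trace = ((∑ i, ∑ j, d j * ‖(Uᴴ * X * U) i j‖ ^ 2 : ℝ) : ℂ) := by
  have hU' : U * Uᴴ = 1 := mul_eq_one_comm.mp hU
  have h1 : (σ * (Xᴴ * X)).trace =
      ((Uᴴ * X * U) * (Matrix.diagonal fun i => (d i : ℂ)) * (Uᴴ * X * U)ᴴ).trace := by
    have h2 : (Uᴴ * X * U) * (Matrix.diagonal fun i => (d i : ℂ)) * (Uᴴ * X * U)ᴴ =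
        Uᴴ * (X * σ * Xᴴ) * U := by
      rw [hσ]
      simp only [Matrix.conjTranspose_mul, Matrix.conjTranspose_conjTranspose, Matrix.mul_assoc]
    rw [h2, Matrix.trace_mul_cycle, hU', Matrix.one_mul, Matrix.trace_mul_cycle, Matrix.mul_assoc,
      Matrix.trace_mul_comm, Matrix.mul_assoc, Matrix.trace_mul_comm]
  rw [h1, Matrix.trace]
  push_cast
  simp only [Matrix.diag_apply, Matrix.mul_apply (N := (Uᴴ * X * U)ᴴ), Matrix.conjTranspose_apply,
    Matrix.mul_diagonal]
  refine Finset.sum_congr rfl fun i _ => Finset.sum_congr rfl fun j _ => ?_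
  rw [← Complex.mul_conj', RCLike.star_def]
  ring

lemma trace_mul_self_mul_conjTranspose (X : Matrix a a ℂ) :
    (σ * (X * Xᴴ)).trace = ((∑ i, ∑ j, d i * ‖(Uᴴ * X * U) i j‖ ^ 2 : ℝ) : ℂ) := by
  have h := trace_mul_conjTranspose_mul_self hU hσ Xᴴ
  rw [Matrix.conjTranspose_conjTranspose] at h
  rw [h, Finset.sum_comm]
  have : Uᴴ * Xᴴ * U = (Uᴴ * X * U)ᴴ := by simp [Matrix.mul_assoc]
  simp [this]

end Eigenbasis

lemma innerF_one {f : ℝ → ℝ} (hf : NormalizedOperatorMonotone f) {a : Type*} [Fintype a]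
    [DecidableEq a] {σ : Matrix a a ℂ} (hσ : σ.PosSemidef) (X : Matrix a a ℂ) :
    innerF f σ 1 X = (σ * X).trace := by
  obtain ⟨U, d, hU, hd, hσ'⟩ := exists_diagonalization hσ
  rw [innerF_eq hU hσ']
  have h1 : (σ * X).trace = ((Matrix.diagonal fun i => (d i : ℂ)) * (Uᴴ * X * U)).trace := by
    rw [hσ', Matrix.mul_assoc, Matrix.mul_assoc, Matrix.trace_mul_comm U]
    simp only [Matrix.mul_assoc]
  rw [h1, Matrix.mul_one, hU, Matrix.trace]
  refine Finset.sum_congr rfl fun i _ => ?_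
  rw [Finset.sum_eq_single i]
  · simp [perspective_self hf (hd i), Matrix.diagonal_mul]
  · intro j _ hj
    simp [hj.symm]
  · simp

lemma innerF_smul_smul (f : ℝ → ℝ) {a : Type*} [Fintype a] [DecidableEq a] {σ : Matrix a a ℂ}
    (hσ : σ.PosSemidef) (c : ℝ) (X : Matrix a a ℂ) :
    innerF f σ (c • X) (c • X) = (c ^ 2 : ℝ) * innerF f σ X X := by
  obtain ⟨U, d, hU, hd, hσ'⟩ := exists_diagonalization hσ
  rw [innerF_self hU hσ', innerF_self hU hσ', ← Complex.ofReal_mul]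
  congr 1
  simp only [Finset.mul_sum, Matrix.mul_smul, Matrix.smul_mul, Matrix.smul_apply, norm_smul,
    mul_pow, Real.norm_eq_abs, sq_abs]
  exact Finset.sum_congr rfl fun i _ => Finset.sum_congr rfl fun j _ => by ring

lemma innerF_self_eq_ofReal {f : ℝ → ℝ} (hf : NormalizedOperatorMonotone f) {a : Type*}
    [Fintype a] [DecidableEq a] {σ : Matrix a a ℂ} (hσ : σ.PosSemidef) (X : Matrix a a ℂ) :
    ∃ s : ℝ, 0 ≤ s ∧ innerF f σ X X = (s : ℂ) := by
  obtain ⟨U, d, hU, hd, hσ'⟩ := exists_diagonalization hσ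
  exact ⟨_, Finset.sum_nonneg fun i _ => Finset.sum_nonneg fun j _ =>
    mul_nonneg (perspective_nonneg hf (hd i) (hd j)) (by positivity), innerF_self hU hσ' f X⟩

lemma trace_mul_nonneg {a : Type*} [Fintype a] [DecidableEq a] {A B : Matrix a a ℂ}
    (hA : A.PosSemidef) (hB : B.PosSemidef) : 0 ≤ (A * B).trace := by
  obtain ⟨C, rfl⟩ : ∃ C : Matrix a a ℂ, A = Cᴴ * C := by
    open scoped MatrixOrder in
    exact CStarAlgebra.nonneg_iff_eq_star_mul_self.mp hA.nonneg
  rw [Matrix.mul_assoc, Matrix.trace_mul_comm]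
  exact (hB.mul_mul_conjTranspose_same C).trace_nonneg

/-! ### Monotonicity under unital Schwarz maps -/

section Schwarz

variable {a b : Type*} [Fintype a] [DecidableEq a] [Fintype b] [DecidableEq b]
  {M : Matrix a a ℂ →ₗ[ℂ] Matrix b b ℂ}

/-- A unital Schwarz map preserves adjoints: positivity makes `M(Z* Z)` Hermitian,
which is used for `Z = X + 1` and `Z = X + i`. -/
lemma IsUnitalSchwarz.map_conjTranspose (hM : IsUnitalSchwarz M) (X : Matrix a a ℂ) :
    M Xᴴ = (M X)ᴴ := by
  have hsq : ∀ Z : Matrix a a ℂ, (M (Zᴴ * Z))ᴴ = M (Zᴴ * Z) := fun Z =>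
    (hM.positive _ (Matrix.posSemidef_conjTranspose_mul_self Z)).1
  have h0 := hsq X
  have h1 := hsq (X + 1)
  have h2 := hsq (X + Complex.I • 1)
  simp only [Matrix.conjTranspose_add, Matrix.conjTranspose_smul, Matrix.conjTranspose_one,
    Matrix.add_mul, Matrix.mul_add, Matrix.smul_mul, Matrix.mul_smul, Matrix.one_mul,
    Matrix.mul_one, map_add, map_smul, hM.map_one, h0, RCLike.star_def, Complex.conj_I,
    map_neg, neg_neg] at h1 h2
  ext i j
  have e1 := congrFun (congrFun h1 i) j
  have e2 := congrFun (congrFun h2 i) j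
  simp only [Matrix.add_apply, Matrix.smul_apply, smul_eq_mul] at e1 e2
  have hI : Complex.I * Complex.I = -1 := Complex.I_mul_I
  have e3 : M Xᴴ i j - (M X)ᴴ i j = 0 := by
    linear_combination (-1/2 : ℂ) * e1 + (Complex.I / 2) * e2 -
      (1/2 : ℂ) * ((M X)ᴴ i j - (M Xᴴ)ᴴ i j + M X i j - M Xᴴ i j) * hI
  exact sub_eq_zero.mp e3

/-- Petz monotonicity: `⟨M X, M X⟩_{f,σ} ≤ ⟨X, X⟩_{f,σ'}` if `σ'` is the image of `σ`
under the adjoint of the unital Schwarz map `M`. The Schwarz inequality for `X` and for `X*` gives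
the two endpoint contractions, between which one interpolates. -/
lemma IsUnitalSchwarz.innerF_le {f : ℝ → ℝ} (hf : NormalizedOperatorMonotone f)
    (hM : IsUnitalSchwarz M) {σ : Matrix b b ℂ} {σ' : Matrix a a ℂ} (hσ : σ.PosSemidef)
    (hσ' : σ'.PosSemidef) (h : ∀ X, (σ' * X).trace = (σ * M X).trace) (X : Matrix a a ℂ) :
    (innerF f σ (M X) (M X)).re ≤ (innerF f σ' X X).re := by
  obtain ⟨U, d, hU, hd, hσd⟩ := exists_diagonalization hσ
  obtain ⟨W, e, hW, he, hσe⟩ := exists_diagonalization hσ'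
  have hW' : W * Wᴴ = 1 := mul_eq_one_comm.mp hW
  -- the map `M` written in the eigenbases of `σ'` and `σ`
  let φ : (a × a → ℂ) →ₗ[ℂ] (b × b → ℂ) :=
    { toFun := fun x z => (Uᴴ * M (W * Matrix.of (fun i j => x (i, j)) * Wᴴ) * U) z.1 z.2
      map_add' := fun x y => by
        have : Uᴴ * M (W * (Matrix.of (fun i j => x (i, j)) + Matrix.of fun i j => y (i, j)) *
            Wᴴ) * U = Uᴴ * M (W * Matrix.of (fun i j => x (i, j)) * Wᴴ) * U +
            Uᴴ * M (W * Matrix.of (fun i j => y (i, j)) * Wᴴ) * U := by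
          simp only [Matrix.mul_add, Matrix.add_mul, map_add]
        exact funext fun z => congrFun (congrFun this z.1) z.2
      map_smul' := fun c x => by
        have : Uᴴ * M (W * (c • Matrix.of fun i j => x (i, j)) * Wᴴ) * U =
            c • (Uᴴ * M (W * Matrix.of (fun i j => x (i, j)) * Wᴴ) * U) := by
          simp only [Matrix.mul_smul, Matrix.smul_mul, map_smul]
        exact funext fun z => congrFun (congrFun this z.1) z.2 }
  have htr : ∀ Z : Matrix a a ℂ, (σ * ((M Z)ᴴ * M Z)).trace.re ≤ (σ' * (Zᴴ * Z)).trace.re := by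
    intro Z
    rw [h]
    have h2 : 0 ≤ (σ * (M (Zᴴ * Z) - (M Z)ᴴ * M Z)).trace :=
      trace_mul_nonneg hσ (hM.schwarz Z)
    rw [Matrix.mul_sub, Matrix.trace_sub] at h2
    have h3 := (Complex.le_def.mp h2).1
    simp only [Complex.zero_re, Complex.sub_re] at h3
    linarith
  have hx : ∀ x : a × a → ℂ, ∃ Z : Matrix a a ℂ, (∀ i j, (Wᴴ * Z * W) i j = x (i, j)) ∧
      ∀ i j, (Uᴴ * M Z * U) i j = φ x (i, j) := by
    intro x
    refine ⟨W * Matrix.of (fun i j => x (i, j)) * Wᴴ, fun i j => ?_, fun i j => rfl⟩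
    rw [Matrix.mul_assoc, Matrix.mul_assoc, Matrix.mul_assoc, hW, Matrix.mul_one,
      ← Matrix.mul_assoc, hW, Matrix.one_mul]
    rfl
  have key := interpolation hf (p := fun z : b × b => d z.1) (q := fun z : b × b => d z.2)
    (p' := fun z : a × a => e z.1) (q' := fun z : a × a => e z.2)
    (fun z => hd _) (fun z => hd _) (fun z => he _) (fun z => he _) (LinearMap.toMatrix' φ)
    (fun x => by
      obtain ⟨Z, hZ, hZ'⟩ := hx x
      have h1 := htr Z
      rw [trace_mul_conjTranspose_mul_self hU hσd, trace_mul_conjTranspose_mul_self hW hσe] at h1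
      simp only [Complex.ofReal_re, hZ, hZ'] at h1
      simpa only [LinearMap.toMatrix'_mulVec, Fintype.sum_prod_type] using h1)
    (fun x => by
      obtain ⟨Z, hZ, hZ'⟩ := hx x
      have h1 := htr Zᴴ
      rw [hM.map_conjTranspose, Matrix.conjTranspose_conjTranspose,
        Matrix.conjTranspose_conjTranspose, trace_mul_self_mul_conjTranspose hU hσd,
        trace_mul_self_mul_conjTranspose hW hσe] at h1
      simp only [Complex.ofReal_re, hZ, hZ'] at h1
      simpa only [LinearMap.toMatrix'_mulVec, Fintype.sum_prod_type] using h1)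
    (fun z => (Wᴴ * X * W) z.1 z.2)
  have hφ : ∀ i j, φ (fun z => (Wᴴ * X * W) z.1 z.2) (i, j) = (Uᴴ * M X * U) i j := by
    intro i j
    have : W * Matrix.of (fun i j => (Wᴴ * X * W) i j) * Wᴴ = X := by
      change W * (Wᴴ * X * W) * Wᴴ = X
      rw [Matrix.mul_assoc, Matrix.mul_assoc, Matrix.mul_assoc, hW', Matrix.mul_one,
        ← Matrix.mul_assoc, hW', Matrix.one_mul]
    change (Uᴴ * M (W * Matrix.of (fun i j => (Wᴴ * X * W) i j) * Wᴴ) * U) i j = _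
    rw [this]
  rw [innerF_self hU hσd, innerF_self hW hσe]
  simpa only [LinearMap.toMatrix'_mulVec, Fintype.sum_prod_type, Complex.ofReal_re, hφ] using key

end Schwarz

/-! ### Marginals and tensor products of maps -/

section Tensor

variable {a b a' b' : Type*} [Fintype a] [DecidableEq a] [Fintype b] [DecidableEq b]
  [Fintype a'] [DecidableEq a'] [Fintype b'] [DecidableEq b']

omit [DecidableEq a] in
lemma trace_kronecker_one_mul (X : Matrix a a ℂ) (ρ : Matrix (a × b) (a × b) ℂ) :
    ((X ⊗ₖ (1 : Matrix b b ℂ)) * ρ).trace = (X * marginalA ρ).trace := by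
  simp only [Matrix.trace, Matrix.diag_apply, Matrix.mul_apply, Fintype.sum_prod_type,
    Matrix.kroneckerMap_apply, marginalA, Matrix.of_apply, Finset.mul_sum, Matrix.one_apply,
    mul_ite, mul_one, mul_zero, ite_mul, zero_mul, Finset.sum_ite_eq, Finset.mem_univ, if_true]
  exact Finset.sum_congr rfl fun i _ => Finset.sum_comm

omit [DecidableEq b] in
lemma trace_one_kronecker_mul (Y : Matrix b b ℂ) (ρ : Matrix (a × b) (a × b) ℂ) :
    (((1 : Matrix a a ℂ) ⊗ₖ Y) * ρ).trace = (Y * marginalB ρ).trace := by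
  simp only [Matrix.trace, Matrix.diag_apply, Matrix.mul_apply, Fintype.sum_prod_type,
    Matrix.kroneckerMap_apply, marginalB, Matrix.of_apply, Finset.mul_sum, Matrix.one_apply,
    ite_mul, one_mul, zero_mul]
  rw [Finset.sum_comm]
  refine Finset.sum_congr rfl fun k _ => ?_
  refine Eq.symm (Finset.sum_comm.trans (Finset.sum_congr rfl fun i _ => Eq.symm ?_))
  rw [Finset.sum_eq_single i]
  · simp
  · intro j _ hj
    simp [hj.symm]
  · simp

omit [Fintype a] [DecidableEq a] [DecidableEq b] in
lemma marginalA_posSemidef [Finite a] {ρ : Matrix (a × b) (a × b) ℂ} (hρ : ρ.PosSemidef) :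
    (marginalA ρ).PosSemidef := by
  have : marginalA ρ = ∑ k, ρ.submatrix (fun i => (i, k)) (fun i => (i, k)) := by
    ext i j
    simp [marginalA, Matrix.sum_apply]
  rw [this]
  exact Matrix.posSemidef_sum _ fun k _ => hρ.submatrix _

omit [Fintype b] [DecidableEq a] [DecidableEq b] in
lemma marginalB_posSemidef [Finite b] {ρ : Matrix (a × b) (a × b) ℂ} (hρ : ρ.PosSemidef) :
    (marginalB ρ).PosSemidef := by
  have : marginalB ρ = ∑ k, ρ.submatrix (fun i => (k, i)) (fun i => (k, i)) := by
    ext i j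
    simp [marginalB, Matrix.sum_apply]
  rw [this]
  exact Matrix.posSemidef_sum _ fun k _ => hρ.submatrix _

/-- `E` and `M` are dual for the bilinear pairing `Tr[X Y]`. For maps that preserve adjoints this
is the same as being adjoint for the Hilbert–Schmidt inner product. -/
def IsTraceDual (E : Matrix a a ℂ →ₗ[ℂ] Matrix a' a' ℂ) (M : Matrix a' a' ℂ →ₗ[ℂ] Matrix a a ℂ) :
    Prop :=
  ∀ S X, (E S * X).trace = (S * M X).trace

omit [DecidableEq a] [DecidableEq a'] in
lemma IsTraceDual.of_isHSAdjoint {E : Matrix a a ℂ →ₗ[ℂ] Matrix a' a' ℂ}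
    {M : Matrix a' a' ℂ →ₗ[ℂ] Matrix a a ℂ} (h : IsHSAdjoint E M) (hM : ∀ X, M Xᴴ = (M X)ᴴ) :
    IsTraceDual E M := by
  intro S X
  have h1 := congrArg star (h S Xᴴ)
  rw [← Matrix.trace_conjTranspose, ← Matrix.trace_conjTranspose, hM] at h1
  simp only [Matrix.conjTranspose_mul, Matrix.conjTranspose_conjTranspose] at h1
  rw [Matrix.trace_mul_comm, h1, Matrix.trace_mul_comm]

variable {E : Matrix a a ℂ →ₗ[ℂ] Matrix a' a' ℂ} {M : Matrix a' a' ℂ →ₗ[ℂ] Matrix a a ℂ}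
  {F : Matrix b b ℂ →ₗ[ℂ] Matrix b' b' ℂ} {N : Matrix b' b' ℂ →ₗ[ℂ] Matrix b b ℂ}

@[simp]
lemma tensorMap_kronecker (S : Matrix a a ℂ) (T : Matrix b b ℂ) :
    tensorMap E F (S ⊗ₖ T) = E S ⊗ₖ F T := by
  simp [tensorMap]

omit [DecidableEq a] [DecidableEq b] [Fintype a] [Fintype b] in
/-- Matrices on `a × b` are spanned by Kronecker products. -/
lemma kronecker_induction [Finite a] [Finite b] {p : Matrix (a × b) (a × b) ℂ → Prop}
    (hz : p 0) (hk : ∀ S T, p (S ⊗ₖ T)) (hadd : ∀ ρ τ, p ρ → p τ → p (ρ + τ))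
    (ρ : Matrix (a × b) (a × b) ℂ) : p ρ := by
  classical
  have := Fintype.ofFinite a
  have := Fintype.ofFinite b
  obtain ⟨t, rfl⟩ := (kroneckerLinearEquiv a a b b ℂ).surjective ρ
  induction t using TensorProduct.induction_on with
  | zero => simpa using hz
  | tmul S T => simpa using hk S T
  | add s t hs ht => simpa using hadd _ _ hs ht

lemma trace_kronecker_mul_tensorMap (hE : IsTraceDual E M) (hF : IsTraceDual F N)
    (X : Matrix a' a' ℂ) (Y : Matrix b' b' ℂ) (ρ : Matrix (a × b) (a × b) ℂ) :
    ((X ⊗ₖ Y) * tensorMap E F ρ).trace = ((M X ⊗ₖ N Y) * ρ).trace := by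
  induction ρ using kronecker_induction with
  | hz => simp
  | hk S T =>
    rw [tensorMap_kronecker, ← Matrix.mul_kronecker_mul, ← Matrix.mul_kronecker_mul,
      Matrix.trace_kronecker, Matrix.trace_kronecker, Matrix.trace_mul_comm X,
      Matrix.trace_mul_comm Y, hE, hF, Matrix.trace_mul_comm S, Matrix.trace_mul_comm T]
  | hadd ρ τ h1 h2 => simp [Matrix.mul_add, h1, h2]

lemma marginalA_tensorMap (hE : IsTraceDual E M) (hF : IsTraceDual F N) (hN : N 1 = 1)
    (ρ : Matrix (a × b) (a × b) ℂ) : marginalA (tensorMap E F ρ) = E (marginalA ρ) := by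
  rw [Matrix.ext_iff_trace_mul_left]
  intro X
  rw [← trace_kronecker_one_mul, trace_kronecker_mul_tensorMap hE hF, hN, trace_kronecker_one_mul,
    Matrix.trace_mul_comm X, hE, Matrix.trace_mul_comm]

lemma marginalB_tensorMap (hE : IsTraceDual E M) (hF : IsTraceDual F N) (hM : M 1 = 1)
    (ρ : Matrix (a × b) (a × b) ℂ) : marginalB (tensorMap E F ρ) = F (marginalB ρ) := by
  rw [Matrix.ext_iff_trace_mul_left]
  intro Y
  rw [← trace_one_kronecker_mul, trace_kronecker_mul_tensorMap hE hF, hM, trace_one_kronecker_mul,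
    Matrix.trace_mul_comm Y, hF, Matrix.trace_mul_comm]

lemma tensorMap_comp {a'' b'' : Type*} [Fintype a''] [DecidableEq a''] [Fintype b'']
    [DecidableEq b''] (E' : Matrix a' a' ℂ →ₗ[ℂ] Matrix a'' a'' ℂ)
    (F' : Matrix b' b' ℂ →ₗ[ℂ] Matrix b'' b'' ℂ) (ρ : Matrix (a × b) (a × b) ℂ) :
    tensorMap E' F' (tensorMap E F ρ) = tensorMap (E' ∘ₗ E) (F' ∘ₗ F) ρ := by
  induction ρ using kronecker_induction with
  | hz => simp
  | hk S T => simp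
  | hadd ρ τ h1 h2 => simp [h1, h2]

lemma tensorMap_id (ρ : Matrix (a × b) (a × b) ℂ) :
    tensorMap LinearMap.id LinearMap.id ρ = ρ := by
  simp [tensorMap]

/-- The conjugation `X ↦ V X V*`. -/
def conjMap (V : Matrix a' a ℂ) : Matrix a a ℂ →ₗ[ℂ] Matrix a' a' ℂ where
  toFun X := V * X * Vᴴ
  map_add' X Y := by rw [Matrix.mul_add, Matrix.add_mul]
  map_smul' c X := by simp

omit [DecidableEq a] [DecidableEq a'] [Fintype a'] in
lemma conjMap_apply (V : Matrix a' a ℂ) (X : Matrix a a ℂ) : conjMap V X = V * X * Vᴴ := rfl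

omit [DecidableEq a] [DecidableEq a'] in
lemma isTraceDual_conjMap (V : Matrix a' a ℂ) : IsTraceDual (conjMap V) (conjMap Vᴴ) := by
  intro S X
  rw [conjMap_apply, conjMap_apply, Matrix.conjTranspose_conjTranspose, Matrix.mul_assoc,
    Matrix.mul_assoc, Matrix.trace_mul_comm]
  simp only [Matrix.mul_assoc]

lemma tensorMap_conjMap (V : Matrix a' a ℂ) (W : Matrix b' b ℂ) (ρ : Matrix (a × b) (a × b) ℂ) :
    tensorMap (conjMap V) (conjMap W) ρ = (V ⊗ₖ W) * ρ * (Vᴴ ⊗ₖ Wᴴ) := by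
  induction ρ using kronecker_induction with
  | hz => simp
  | hk S T =>
    rw [tensorMap_kronecker, conjMap_apply, conjMap_apply, ← Matrix.mul_kronecker_mul,
      ← Matrix.mul_kronecker_mul]
  | hadd ρ τ h1 h2 => rw [map_add, h1, h2, Matrix.mul_add, Matrix.add_mul]

/-- The trace dual of a unital Schwarz map is positive. -/
lemma IsTraceDual.posSemidef (hE : IsTraceDual E M) (hM : IsUnitalSchwarz M)
    {σ : Matrix a a ℂ} (hσ : σ.PosSemidef) : (E σ).PosSemidef := by
  have hherm : (E σ)ᴴ = E σ := by
    rw [Matrix.ext_iff_trace_mul_right]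
    intro X
    rw [hE, ← Matrix.conjTranspose_conjTranspose X, ← Matrix.conjTranspose_mul,
      Matrix.trace_conjTranspose, Matrix.trace_mul_comm, hE, ← Matrix.trace_conjTranspose,
      Matrix.conjTranspose_mul, hσ.1, Matrix.trace_mul_comm, hM.map_conjTranspose,
      Matrix.conjTranspose_conjTranspose]
    simp
  refine Matrix.PosSemidef.of_dotProduct_mulVec_nonneg hherm fun x => ?_
  have h1 : star x ⬝ᵥ (E σ *ᵥ x) = (E σ * Matrix.vecMulVec x (star x)).trace := by
    rw [Matrix.mul_vecMulVec, Matrix.trace_vecMulVec, dotProduct_comm]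
  rw [h1, hE]
  exact trace_mul_nonneg hσ (hM.positive _ (Matrix.posSemidef_vecMulVec_self_star x))

end Tensor

/-! ### Finiteness and data processing -/

section Correlation

variable {a b a' b' : Type*} [Fintype a] [DecidableEq a] [Fintype b] [DecidableEq b]
  [Fintype a'] [DecidableEq a'] [Fintype b'] [DecidableEq b'] {f : ℝ → ℝ}

lemma apply_eq_zero_of_diag_eq_zero {R : Matrix a a ℂ} (hR : R.PosSemidef) {z w : a}
    (hz : R z z = 0) : R z w = 0 ∧ R w z = 0 := by
  have h1 : star (Pi.single z 1 : a → ℂ) ⬝ᵥ (R *ᵥ Pi.single z 1) = 0 := by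
    simp [hz]
  have h2 := (hR.dotProduct_mulVec_zero_iff _).mp h1
  have h3 : R w z = 0 := by simpa using congrFun h2 w
  refine ⟨?_, h3⟩
  rw [← hR.1.apply, h3, star_zero]

/-- If the marginals of a positive semidefinite matrix are diagonal, a nonzero entry forces the
corresponding diagonal entries of the marginals to be positive. -/
lemma pos_of_apply_ne_zero {R : Matrix (a × b) (a × b) ℂ} (hR : R.PosSemidef) {d : a → ℝ}
    {e : b → ℝ} (hd : ∀ i, marginalA R i i = d i) (he : ∀ k, marginalB R k k = e k)
    {i j : a} {k l : b} (h : R (j, l) (i, k) ≠ 0) : 0 < d i ∧ 0 < d j ∧ 0 < e k ∧ 0 < e l := by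
  have hdiag : ∀ z, 0 ≤ R z z := fun z => hR.diag_nonneg
  have key : ∀ i k, R (i, k) (i, k) ≠ 0 → 0 < d i ∧ 0 < e k := by
    intro i k hne
    have hpos : 0 < R (i, k) (i, k) := (hdiag _).lt_of_ne' hne
    constructor
    · have h1 : R (i, k) (i, k) ≤ (d i : ℂ) := by
        rw [← hd i]
        exact Finset.single_le_sum (f := fun k => R (i, k) (i, k)) (fun k _ => hdiag (i, k))
          (Finset.mem_univ k)
      exact Complex.zero_lt_real.mp (hpos.trans_le h1)
    · have h1 : R (i, k) (i, k) ≤ (e k : ℂ) := by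
        rw [← he k]
        exact Finset.single_le_sum (f := fun i => R (i, k) (i, k)) (fun i _ => hdiag (i, k))
          (Finset.mem_univ i)
      exact Complex.zero_lt_real.mp (hpos.trans_le h1)
  have h1 := key i k fun h0 => h (apply_eq_zero_of_diag_eq_zero hR h0).2
  have h2 := key j l fun h0 => h (apply_eq_zero_of_diag_eq_zero hR h0).1
  exact ⟨h1.1, h2.1, h1.2, h2.2⟩

/-- A weighted matrix entry is bounded by the norm `⟨X, X⟩_{f,σ}`. -/
lemma norm_apply_le (hf : NormalizedOperatorMonotone f) {σ U : Matrix a a ℂ} {d : a → ℝ}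
    (hU : Uᴴ * U = 1) (hσ : σ = U * (Matrix.diagonal fun i => (d i : ℂ)) * Uᴴ)
    (hd : ∀ i, 0 ≤ d i) (X : Matrix a a ℂ) {i j : a} (hi : 0 < d i) (hj : 0 < d j) :
    ‖(Uᴴ * X * U) i j‖ ≤ (√(perspective f (d i) (d j)))⁻¹ * √(innerF f σ X X).re := by
  have hP := perspective_pos hf hi hj
  rw [← div_eq_inv_mul, ← Real.sqrt_div' _ hP.le]
  refine Real.le_sqrt_of_sq_le ?_
  rw [le_div_iff₀ hP, innerF_self hU hσ, Complex.ofReal_re, mul_comm]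
  have h0 : ∀ i j, 0 ≤ perspective f (d i) (d j) * ‖(Uᴴ * X * U) i j‖ ^ 2 := fun i j =>
    mul_nonneg (perspective_nonneg hf (hd i) (hd j)) (by positivity)
  calc _ ≤ ∑ j, perspective f (d i) (d j) * ‖(Uᴴ * X * U) i j‖ ^ 2 :=
        Finset.single_le_sum (f := fun j => perspective f (d i) (d j) * ‖(Uᴴ * X * U) i j‖ ^ 2)
          (fun j _ => h0 i j) (Finset.mem_univ j)
    _ ≤ _ := Finset.single_le_sum
          (f := fun i => ∑ j, perspective f (d i) (d j) * ‖(Uᴴ * X * U) i j‖ ^ 2)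
          (fun i _ => Finset.sum_nonneg fun j _ => h0 i j) (Finset.mem_univ i)

omit [Fintype b] [DecidableEq b] in
lemma conjTranspose_mul_mul_of_diagonalization {σ U : Matrix a a ℂ} {d : a → ℝ}
    (hU : Uᴴ * U = 1) (hσ : σ = U * (Matrix.diagonal fun i => (d i : ℂ)) * Uᴴ) :
    Uᴴ * σ * U = Matrix.diagonal fun i => (d i : ℂ) := by
  rw [hσ]
  simp only [Matrix.mul_assoc, hU, Matrix.mul_one]
  rw [← Matrix.mul_assoc, hU, Matrix.one_mul]

/-- The correlation of `X` and `Y` is bounded by a multiple of the product of their norms. In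
eigenbases of the marginals the state is supported on the entries where the weights
`P_f(λ_i, λ_j)` are positive. -/
lemma exists_correlation_bound (hf : NormalizedOperatorMonotone f)
    {ρ : Matrix (a × b) (a × b) ℂ} (hρ : ρ.PosSemidef) :
    ∃ C : ℝ, ∀ (X : Matrix a a ℂ) (Y : Matrix b b ℂ), ‖((X ⊗ₖ Yᴴ) * ρ).trace‖ ≤
      C * √(innerF f (marginalA ρ) X X).re * √(innerF f (marginalB ρ) Y Y).re := by
  obtain ⟨U, d, hU, hd, hσA⟩ := exists_diagonalization (marginalA_posSemidef hρ)
  obtain ⟨W, e, hW, he, hσB⟩ := exists_diagonalization (marginalB_posSemidef hρ)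
  have hU' : U * Uᴴ = 1 := mul_eq_one_comm.mp hU
  have hW' : W * Wᴴ = 1 := mul_eq_one_comm.mp hW
  have hdA := isTraceDual_conjMap Uᴴ
  have hdB := isTraceDual_conjMap Wᴴ
  rw [Matrix.conjTranspose_conjTranspose] at hdA hdB
  -- the state in the eigenbases of its marginals
  set R := tensorMap (conjMap Uᴴ) (conjMap Wᴴ) ρ with hRdef
  have hR : R.PosSemidef := by
    have h1 := hρ.mul_mul_conjTranspose_same (Uᴴ ⊗ₖ Wᴴ)
    rwa [Matrix.conjTranspose_kronecker, ← tensorMap_conjMap] at h1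
  have hRA : ∀ i, marginalA R i i = d i := fun i => by
    have h1 : marginalA R = conjMap Uᴴ (marginalA ρ) :=
      marginalA_tensorMap hdA hdB (by rw [conjMap_apply, Matrix.mul_one, hW']) ρ
    rw [h1, conjMap_apply, Matrix.conjTranspose_conjTranspose,
      conjTranspose_mul_mul_of_diagonalization hU hσA, Matrix.diagonal_apply_eq]
  have hRB : ∀ i, marginalB R i i = e i := fun i => by
    have h1 : marginalB R = conjMap Wᴴ (marginalB ρ) :=
      marginalB_tensorMap hdA hdB (by rw [conjMap_apply, Matrix.mul_one, hU']) ρ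
    rw [h1, conjMap_apply, Matrix.conjTranspose_conjTranspose,
      conjTranspose_mul_mul_of_diagonalization hW hσB, Matrix.diagonal_apply_eq]
  have htr : ∀ (X : Matrix a a ℂ) (Y : Matrix b b ℂ), ((X ⊗ₖ Yᴴ) * ρ).trace =
      (((Uᴴ * X * U) ⊗ₖ (Wᴴ * Y * W)ᴴ) * R).trace := by
    intro X Y
    rw [hRdef, trace_kronecker_mul_tensorMap hdA hdB, conjMap_apply, conjMap_apply]
    have h1 : U * (Uᴴ * X * U) * Uᴴ = X := by
      simp only [Matrix.mul_assoc, hU', Matrix.mul_one]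
      rw [← Matrix.mul_assoc, hU', Matrix.one_mul]
    have h2 : W * (Wᴴ * Y * W)ᴴ * Wᴴ = Yᴴ := by
      simp only [Matrix.conjTranspose_mul, Matrix.conjTranspose_conjTranspose, Matrix.mul_assoc,
        hW', Matrix.mul_one]
      rw [← Matrix.mul_assoc, hW', Matrix.one_mul]
    rw [h1, h2]
  refine ⟨∑ z : a × b, ∑ w : a × b, (√(perspective f (d z.1) (d w.1)))⁻¹ *
    (√(perspective f (e w.2) (e z.2)))⁻¹ * ‖R w z‖, fun X Y => ?_⟩
  rw [htr, Matrix.trace]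
  simp only [Matrix.diag_apply, Matrix.mul_apply (M := _ ⊗ₖ _), Matrix.kroneckerMap_apply,
    Matrix.conjTranspose_apply]
  simp only [Finset.sum_mul]
  refine (norm_sum_le _ _).trans (Finset.sum_le_sum fun z _ => (norm_sum_le _ _).trans
    (Finset.sum_le_sum fun w _ => ?_))
  by_cases h0 : R w z = 0
  · simp [h0]
  obtain ⟨h1, h2, h3, h4⟩ := pos_of_apply_ne_zero hR hRA hRB (j := w.1) (l := w.2) (i := z.1)
    (k := z.2) h0
  rw [norm_mul, norm_mul, norm_star]
  calc _ ≤ ((√(perspective f (d z.1) (d w.1)))⁻¹ * √(innerF f (marginalA ρ) X X).re) *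
        ((√(perspective f (e w.2) (e z.2)))⁻¹ * √(innerF f (marginalB ρ) Y Y).re) * ‖R w z‖ := by
        refine mul_le_mul_of_nonneg_right (mul_le_mul (norm_apply_le hf hU hσA hd X h1 h2)
          (norm_apply_le hf hW hσB he Y h4 h3) (norm_nonneg _) (by positivity)) (norm_nonneg _)
    _ = _ := by ring

lemma muLin_ne_top (hf : NormalizedOperatorMonotone f) {ρ : Matrix (a × b) (a × b) ℂ}
    (hρ : ρ.PosSemidef) : muLin f ρ ≠ ⊤ := by
  obtain ⟨C, hC⟩ := exists_correlation_bound hf hρ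
  refine ne_top_of_le_ne_top (ENNReal.ofReal_ne_top (r := C)) ?_
  refine iSup_le fun X => iSup_le fun Y => iSup_le fun hX => iSup_le fun hY => ?_
  rw [← ofReal_norm]
  refine ENNReal.ofReal_le_ofReal ?_
  simpa [hX.2, hY.2] using hC X Y

lemma mu_le_muLin (f : ℝ → ℝ) (ρ : Matrix (a × b) (a × b) ℂ) : mu f ρ ≤ muLin f ρ :=
  iSup_le fun X => iSup_le fun Y => iSup_le fun _ => iSup_le fun _ => iSup_le fun hX =>
    iSup_le fun hY => le_iSup_of_le X <| le_iSup_of_le Y <| le_iSup_of_le hX <|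
      le_iSup_of_le hY le_rfl

lemma feasible_inv_sqrt_smul (hf : NormalizedOperatorMonotone f) {σ X : Matrix a a ℂ}
    (hσ : σ.PosSemidef) (h0 : innerF f σ 1 X = 0) (h1 : 0 < (innerF f σ X X).re) :
    Feasible f σ ((√(innerF f σ X X).re)⁻¹ • X) := by
  obtain ⟨s, -, hs⟩ := innerF_self_eq_ofReal hf hσ X
  rw [hs, Complex.ofReal_re] at h1 ⊢
  constructor
  · rw [innerF_one hf hσ] at h0 ⊢
    rw [Matrix.mul_smul, Matrix.trace_smul, h0, smul_zero]
  · rw [innerF_smul_smul f hσ, hs, ← Complex.ofReal_mul, inv_pow, Real.sq_sqrt h1.le,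
      inv_mul_cancel₀ h1.ne', Complex.ofReal_one]

/-- Observables of mean zero and second moment at most `1` are, as far as the size of their
correlation is concerned, no better than feasible ones obtained by real rescaling. -/
lemma trace_eq_zero_or_exists_feasible (hf : NormalizedOperatorMonotone f)
    {ρ : Matrix (a × b) (a × b) ℂ} (hρ : ρ.PosSemidef) {X : Matrix a a ℂ} {Y : Matrix b b ℂ}
    (hX0 : innerF f (marginalA ρ) 1 X = 0) (hX1 : (innerF f (marginalA ρ) X X).re ≤ 1)
    (hY0 : innerF f (marginalB ρ) 1 Y = 0) (hY1 : (innerF f (marginalB ρ) Y Y).re ≤ 1) :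
    ((X ⊗ₖ Yᴴ) * ρ).trace = 0 ∨ ∃ s t : ℝ, Feasible f (marginalA ρ) (s • X) ∧
      Feasible f (marginalB ρ) (t • Y) ∧
      ‖((X ⊗ₖ Yᴴ) * ρ).trace‖ₑ ≤ ‖(((s • X) ⊗ₖ (t • Y)ᴴ) * ρ).trace‖ₑ := by
  have hA := marginalA_posSemidef hρ
  have hB := marginalB_posSemidef hρ
  obtain ⟨C, hC⟩ := exists_correlation_bound hf hρ
  rcases le_or_gt (innerF f (marginalA ρ) X X).re 0 with h | hX
  · left
    simpa [Real.sqrt_eq_zero_of_nonpos h] using hC X Y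
  rcases le_or_gt (innerF f (marginalB ρ) Y Y).re 0 with h | hY
  · left
    simpa [Real.sqrt_eq_zero_of_nonpos h] using hC X Y
  refine Or.inr ⟨_, _, feasible_inv_sqrt_smul hf hA hX0 hX, feasible_inv_sqrt_smul hf hB hY0 hY, ?_⟩
  set s := (√(innerF f (marginalA ρ) X X).re)⁻¹
  set t := (√(innerF f (marginalB ρ) Y Y).re)⁻¹
  have hs : 1 ≤ s := (one_le_inv₀ (Real.sqrt_pos.mpr hX)).mpr (Real.sqrt_le_one.mpr hX1)
  have ht : 1 ≤ t := (one_le_inv₀ (Real.sqrt_pos.mpr hY)).mpr (Real.sqrt_le_one.mpr hY1)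
  rw [Matrix.conjTranspose_smul, star_trivial, Matrix.smul_kronecker, Matrix.kronecker_smul,
    smul_smul, Matrix.smul_mul, Matrix.trace_smul, enorm_le_iff_norm_le, norm_smul]
  refine le_mul_of_one_le_left (norm_nonneg _) ?_
  rw [Real.norm_of_nonneg (by positivity)]
  exact one_le_mul_of_one_le_of_one_le hs ht

/-- Data processing: the dual maps carry feasible observables of the image state to observables of
mean zero and second moment at most `1` of the original state, with the same correlation. -/
lemma data_processing (hf : NormalizedOperatorMonotone f) {ρ : Matrix (a × b) (a × b) ℂ}
    (hρ : ρ.PosSemidef) {E : Matrix a a ℂ →ₗ[ℂ] Matrix a' a' ℂ}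
    {F : Matrix b b ℂ →ₗ[ℂ] Matrix b' b' ℂ} (hE : IsAdjointOfUnitalSchwarz E)
    (hF : IsAdjointOfUnitalSchwarz F) :
    mu f (tensorMap E F ρ) ≤ mu f ρ ∧ muLin f (tensorMap E F ρ) ≤ muLin f ρ := by
  obtain ⟨M, hM, hEM⟩ := hE
  obtain ⟨N, hN, hFN⟩ := hF
  have hE := IsTraceDual.of_isHSAdjoint hEM hM.map_conjTranspose
  have hF := IsTraceDual.of_isHSAdjoint hFN hN.map_conjTranspose
  have hA := marginalA_posSemidef hρ
  have hB := marginalB_posSemidef hρ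
  have key : ∀ X Y, Feasible f (marginalA (tensorMap E F ρ)) X →
      Feasible f (marginalB (tensorMap E F ρ)) Y →
      ‖((X ⊗ₖ Yᴴ) * tensorMap E F ρ).trace‖ₑ = 0 ∨ ∃ s t : ℝ, Feasible f (marginalA ρ) (s • M X) ∧
        Feasible f (marginalB ρ) (t • N Y) ∧ ‖((X ⊗ₖ Yᴴ) * tensorMap E F ρ).trace‖ₑ ≤
          ‖(((s • M X) ⊗ₖ (t • N Y)ᴴ) * ρ).trace‖ₑ := by
    rw [marginalA_tensorMap hE hF hN.map_one, marginalB_tensorMap hE hF hM.map_one]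
    intro X Y hX hY
    rw [trace_kronecker_mul_tensorMap hE hF, hN.map_conjTranspose, enorm_eq_zero]
    refine trace_eq_zero_or_exists_feasible hf hρ ?_ ?_ ?_ ?_
    · rw [innerF_one hf hA, ← hE, ← innerF_one hf (hE.posSemidef hM hA), hX.1]
    · refine (hM.innerF_le hf hA (hE.posSemidef hM hA) (hE _) X).trans ?_
      rw [hX.2, Complex.one_re]
    · rw [innerF_one hf hB, ← hF, ← innerF_one hf (hF.posSemidef hN hB), hY.1]
    · refine (hN.innerF_le hf hB (hF.posSemidef hN hB) (hF _) Y).trans ?_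
      rw [hY.2, Complex.one_re]
  constructor
  · refine iSup_le fun X => iSup_le fun Y => iSup_le fun hXh => iSup_le fun hYh =>
      iSup_le fun hX => iSup_le fun hY => ?_
    rcases key X Y hX hY with h | ⟨s, t, hs, ht, h⟩
    · rw [h]
      exact zero_le
    · refine h.trans (le_iSup_of_le (s • M X) <| le_iSup_of_le (t • N Y) <| le_iSup_of_le ?_ <|
        le_iSup_of_le ?_ <| le_iSup_of_le hs <| le_iSup_of_le ht le_rfl)
      · rw [Matrix.IsHermitian, Matrix.conjTranspose_smul, ← hM.map_conjTranspose, hXh, star_trivial]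
      · rw [Matrix.IsHermitian, Matrix.conjTranspose_smul, ← hN.map_conjTranspose, hYh, star_trivial]
  · refine iSup_le fun X => iSup_le fun Y => iSup_le fun hX => iSup_le fun hY => ?_
    rcases key X Y hX hY with h | ⟨s, t, hs, ht, h⟩
    · rw [h]
      exact zero_le
    · exact h.trans (le_iSup_of_le (s • M X) <| le_iSup_of_le (t • N Y) <| le_iSup_of_le hs <|
        le_iSup_of_le ht le_rfl)

end Correlation

/-! ### Isometric invariance -/

section Isometry

variable {a a' : Type*} [Fintype a] [DecidableEq a] [Fintype a'] [DecidableEq a']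

lemma isAdjointOfUnitalSchwarz_conjMap {V : Matrix a' a ℂ} (hV : Vᴴ * V = 1) :
    IsAdjointOfUnitalSchwarz (conjMap V) := by
  refine ⟨conjMap Vᴴ, ⟨?_, fun X hX => ?_, fun X => ?_⟩, fun X Y => ?_⟩
  · rw [conjMap_apply, Matrix.mul_one, Matrix.conjTranspose_conjTranspose, hV]
  · exact hX.mul_mul_conjTranspose_same _
  · -- the Schwarz defect is `(X V)* (1 - V V*) (X V)`, and `1 - V V*` is a projection
    have h1 : (1 - V * Vᴴ)ᴴ * (1 - V * Vᴴ) = 1 - V * Vᴴ := by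
      have h2 : V * Vᴴ * (V * Vᴴ) = V * Vᴴ := by
        rw [Matrix.mul_assoc, ← Matrix.mul_assoc Vᴴ, hV, Matrix.one_mul]
      have h3 : (1 - V * Vᴴ)ᴴ = 1 - V * Vᴴ := by simp
      rw [h3, Matrix.mul_sub, Matrix.sub_mul, Matrix.sub_mul, h2]
      simp
    have h2 := ((Matrix.posSemidef_conjTranspose_mul_self
      (1 - V * Vᴴ)).conjTranspose_mul_mul_same (X * V))
    rw [h1, Matrix.mul_sub, Matrix.sub_mul] at h2
    convert h2 using 1
    simp only [conjMap_apply, Matrix.conjTranspose_mul, Matrix.conjTranspose_conjTranspose,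
      Matrix.mul_assoc, Matrix.mul_one]
  · have h1 := isTraceDual_conjMap V Xᴴ Y
    have h2 : (conjMap V X)ᴴ = conjMap V Xᴴ := by
      simp [conjMap_apply, Matrix.mul_assoc]
    rw [h2, h1]

/-- The map `S ↦ V* S V + Tr[(1 - V V*) S] |i₀⟩⟨i₀|`, a left inverse of `S ↦ V S V*` for an isometry
`V`. The second term, supported on an arbitrary basis state, makes it trace preserving. -/
def compressMap (V : Matrix a' a ℂ) (i₀ : a) : Matrix a' a' ℂ →ₗ[ℂ] Matrix a a ℂ where
  toFun S := Vᴴ * S * V + ((1 - V * Vᴴ) * S).trace • Matrix.single i₀ i₀ (1 : ℂ)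
  map_add' S T := by
    rw [Matrix.mul_add, Matrix.mul_add, Matrix.add_mul, Matrix.trace_add, add_smul]
    abel
  map_smul' c S := by
    simp only [Matrix.mul_smul, Matrix.smul_mul, Matrix.trace_smul, smul_add, smul_smul,
      RingHom.id_apply, smul_eq_mul]

/-- The adjoint `X ↦ V X V* + X_{i₀ i₀} (1 - V V*)` of `compressMap`. -/
def expandMap (V : Matrix a' a ℂ) (i₀ : a) : Matrix a a ℂ →ₗ[ℂ] Matrix a' a' ℂ where
  toFun X := V * X * Vᴴ + X i₀ i₀ • (1 - V * Vᴴ)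
  map_add' S T := by
    rw [Matrix.mul_add, Matrix.add_mul, Matrix.add_apply, add_smul]
    abel
  map_smul' c S := by
    simp only [Matrix.mul_smul, Matrix.smul_mul, Matrix.smul_apply, smul_add, smul_smul,
      RingHom.id_apply, smul_eq_mul]

variable {V : Matrix a' a ℂ} (hV : Vᴴ * V = 1) (i₀ : a)
include hV

lemma isAdjointOfUnitalSchwarz_compressMap : IsAdjointOfUnitalSchwarz (compressMap V i₀) := by
  have hVQ : Vᴴ * (1 - V * Vᴴ) = 0 := by
    rw [Matrix.mul_sub, ← Matrix.mul_assoc, hV]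
    simp
  have hQh : (1 - V * Vᴴ)ᴴ = 1 - V * Vᴴ := by simp
  have hQV : (1 - V * Vᴴ) * V = 0 := by
    rw [Matrix.sub_mul, Matrix.mul_assoc, hV]
    simp
  have hQQ : (1 - V * Vᴴ)ᴴ * (1 - V * Vᴴ) = 1 - V * Vᴴ := by
    rw [hQh, Matrix.sub_mul _ _ (1 - V * Vᴴ), Matrix.mul_assoc, hVQ]
    simp
  have hQ : (1 - V * Vᴴ).PosSemidef := hQQ ▸ Matrix.posSemidef_conjTranspose_mul_self _
  have happ : ∀ X, expandMap V i₀ X = V * X * Vᴴ + X i₀ i₀ • (1 - V * Vᴴ) := fun _ => rfl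
  have happ' : ∀ S, compressMap V i₀ S =
    Vᴴ * S * V + ((1 - V * Vᴴ) * S).trace • Matrix.single i₀ i₀ (1 : ℂ) := fun _ => rfl
  generalize hQdef : 1 - V * Vᴴ = Q at *
  refine ⟨expandMap V i₀, ⟨?_, fun X hX => ?_, fun X => ?_⟩, fun X Y => ?_⟩
  · rw [happ, Matrix.mul_one, Matrix.one_apply_eq, one_smul, ← hQdef]
    simp
  · rw [happ]
    exact (hX.mul_mul_conjTranspose_same V).add (hQ.smul hX.diag_nonneg)
  · have h1 : expandMap V i₀ (Xᴴ * X) - (expandMap V i₀ X)ᴴ * expandMap V i₀ X =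
        ((Xᴴ * X) i₀ i₀ - star (X i₀ i₀) * X i₀ i₀) • Q := by
      have h2 : (expandMap V i₀ X)ᴴ * expandMap V i₀ X =
          V * (Xᴴ * X) * Vᴴ + (star (X i₀ i₀) * X i₀ i₀) • Q := by
        rw [happ, Matrix.conjTranspose_add, Matrix.conjTranspose_smul, Matrix.add_mul,
          Matrix.mul_add, Matrix.mul_add]
        have e1 : (V * X * Vᴴ)ᴴ * (V * X * Vᴴ) = V * (Xᴴ * X) * Vᴴ := by
          simp only [Matrix.conjTranspose_mul, Matrix.conjTranspose_conjTranspose,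
            Matrix.mul_assoc]
          rw [← Matrix.mul_assoc Vᴴ V, hV, Matrix.one_mul]
        have e2 : (V * X * Vᴴ)ᴴ * (X i₀ i₀ • Q) = 0 := by
          simp only [Matrix.conjTranspose_mul, Matrix.conjTranspose_conjTranspose,
            Matrix.mul_assoc, Matrix.mul_smul, hVQ, Matrix.mul_zero, smul_zero]
        have e3 : (star (X i₀ i₀) • Qᴴ) * (V * X * Vᴴ) = 0 := by
          rw [hQh, Matrix.smul_mul, ← Matrix.mul_assoc, ← Matrix.mul_assoc, hQV]
          simp
        have e4 : (star (X i₀ i₀) • Qᴴ) * (X i₀ i₀ • Q) = (star (X i₀ i₀) * X i₀ i₀) • Q := by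
          rw [Matrix.smul_mul, Matrix.mul_smul, hQQ, smul_smul]
        rw [e1, e2, e3, e4, add_zero, zero_add]
      rw [h2, happ, sub_smul]
      abel
    rw [h1]
    refine hQ.smul ?_
    rw [Matrix.mul_apply, sub_nonneg]
    simp only [Matrix.conjTranspose_apply]
    exact Finset.single_le_sum (f := fun k => star (X k i₀) * X k i₀)
      (fun k _ => star_mul_self_nonneg (X k i₀)) (Finset.mem_univ i₀)
  · rw [happ, happ', Matrix.conjTranspose_add, Matrix.conjTranspose_smul, Matrix.add_mul,
      Matrix.mul_add, Matrix.trace_add, Matrix.trace_add]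
    congr 1
    · simp only [Matrix.conjTranspose_mul, Matrix.conjTranspose_conjTranspose, Matrix.mul_assoc]
      rw [Matrix.trace_mul_comm]
      simp only [Matrix.mul_assoc]
    · rw [Matrix.mul_smul, Matrix.smul_mul, Matrix.trace_smul, Matrix.trace_smul,
        ← Matrix.trace_conjTranspose, Matrix.conjTranspose_mul, hQh, Matrix.conjTranspose_single,
        star_one, Matrix.trace_single_mul, smul_eq_mul, smul_eq_mul, one_mul, mul_comm,
        smul_eq_mul]

lemma compressMap_comp_conjMap : compressMap V i₀ ∘ₗ conjMap V = LinearMap.id := by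
  ext1 X
  change Vᴴ * (V * X * Vᴴ) * V +
    ((1 - V * Vᴴ) * (V * X * Vᴴ)).trace • Matrix.single i₀ i₀ (1 : ℂ) = X
  have hQV : (1 - V * Vᴴ) * (V * X * Vᴴ) = 0 := by
    rw [Matrix.mul_assoc V, ← Matrix.mul_assoc, Matrix.sub_mul, Matrix.mul_assoc V, hV]
    simp
  rw [hQV, Matrix.trace_zero, zero_smul, add_zero]
  simp only [Matrix.mul_assoc, hV, Matrix.mul_one]
  rw [← Matrix.mul_assoc, hV, Matrix.one_mul]

end Isometry

lemma isometric_invariance {a b a' b' : Type*} [Fintype a] [DecidableEq a] [Fintype b]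
    [DecidableEq b] [Fintype a'] [DecidableEq a'] [Fintype b'] [DecidableEq b'] {f : ℝ → ℝ}
    (hf : NormalizedOperatorMonotone f) {ρ : Matrix (a × b) (a × b) ℂ} (hρ : IsState ρ)
    {V : Matrix a' a ℂ} {W : Matrix b' b ℂ} (hV : Vᴴ * V = 1) (hW : Wᴴ * W = 1) :
    mu f ρ = mu f ((V ⊗ₖ W) * ρ * (Vᴴ ⊗ₖ Wᴴ)) ∧
      muLin f ρ = muLin f ((V ⊗ₖ W) * ρ * (Vᴴ ⊗ₖ Wᴴ)) := by
  obtain ⟨i₀, k₀⟩ : Nonempty (a × b) := by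
    by_contra h
    have := not_nonempty_iff.mp h
    have h1 := hρ.2
    rw [Matrix.trace, Finset.univ_eq_empty, Finset.sum_empty] at h1
    exact zero_ne_one h1
  have hρ' : ((V ⊗ₖ W) * ρ * (Vᴴ ⊗ₖ Wᴴ)).PosSemidef := by
    have h1 := hρ.1.mul_mul_conjTranspose_same (V ⊗ₖ W)
    rwa [Matrix.conjTranspose_kronecker] at h1
  have h1 := data_processing hf hρ.1 (isAdjointOfUnitalSchwarz_conjMap hV)
    (isAdjointOfUnitalSchwarz_conjMap hW)
  have h2 := data_processing hf hρ' (isAdjointOfUnitalSchwarz_compressMap hV i₀)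
    (isAdjointOfUnitalSchwarz_compressMap hW k₀)
  rw [← tensorMap_conjMap] at h2 ⊢
  rw [tensorMap_comp, compressMap_comp_conjMap hV, compressMap_comp_conjMap hW, tensorMap_id] at h2
  exact ⟨le_antisymm h2.1 h1.1, le_antisymm h2.2 h1.2⟩

/-! ### Classical states -/

section Classical

variable {a b : Type*} [Fintype a] [Fintype b] {p : a × b → ℝ}

lemma sum_mul_mul_eq_zero (hp : ∀ z, 0 ≤ p z) {g : a × b → ℝ} (h : a × b → ℝ)
    (hg : ∑ z, p z * g z ^ 2 = 0) : ∑ z, p z * (g z * h z) = 0 := by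
  have h1 := (Finset.sum_eq_zero_iff_of_nonneg fun z _ =>
    mul_nonneg (hp z) (sq_nonneg (g z))).mp hg
  refine Finset.sum_eq_zero fun z hz => ?_
  rcases mul_eq_zero.mp (h1 z hz) with h2 | h2
  · simp [h2]
  · simp [pow_eq_zero_iff two_ne_zero |>.mp h2]

lemma abs_sum_mul_mul_le (hp : ∀ z, 0 ≤ p z) (g h : a × b → ℝ) :
    |∑ z, p z * (g z * h z)| ≤ (∑ z, p z * g z ^ 2 + ∑ z, p z * h z ^ 2) / 2 := by
  rw [← Finset.sum_add_distrib, Finset.sum_div]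
  refine (Finset.abs_sum_le_sum_abs _ _).trans (Finset.sum_le_sum fun z _ => ?_)
  rw [abs_mul, abs_of_nonneg (hp z), ← mul_add, mul_div_assoc]
  refine mul_le_mul_of_nonneg_left ?_ (hp z)
  rw [abs_le]
  constructor <;> nlinarith [sq_nonneg (g z - h z), sq_nonneg (g z + h z)]

lemma classicalMaxCorr_ne_top (hp : ∀ z, 0 ≤ p z) : classicalMaxCorr p ≠ ⊤ := by
  refine ne_top_of_le_ne_top ENNReal.one_ne_top ?_
  refine iSup_le fun g => iSup_le fun h => iSup_le fun _ => iSup_le fun _ => iSup_le fun hg =>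
    iSup_le fun hh => ?_
  have h1 := abs_sum_mul_mul_le hp (fun z => g z.1) (fun z => h z.2)
  rw [hg, hh] at h1
  rw [← ofReal_norm, ← ENNReal.ofReal_one]
  refine ENNReal.ofReal_le_ofReal ?_
  rw [Real.norm_eq_abs]
  linarith

/-- The defining bound of the maximal correlation, for functions that need not be normalized. -/
lemma abs_sum_le_classicalMaxCorr (hp : ∀ z, 0 ≤ p z) {g : a → ℝ} {h : b → ℝ}
    (hg : ∑ z, p z * g z.1 = 0) (hh : ∑ z, p z * h z.2 = 0) :
    |∑ z, p z * (g z.1 * h z.2)| ≤ (classicalMaxCorr p).toReal *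
      (√(∑ z, p z * g z.1 ^ 2) * √(∑ z, p z * h z.2 ^ 2)) := by
  have hs0 : 0 ≤ ∑ z, p z * g z.1 ^ 2 :=
    Finset.sum_nonneg fun z _ => mul_nonneg (hp z) (sq_nonneg _)
  have ht0 : 0 ≤ ∑ z, p z * h z.2 ^ 2 :=
    Finset.sum_nonneg fun z _ => mul_nonneg (hp z) (sq_nonneg _)
  rcases hs0.eq_or_lt with hs | hs
  · rw [sum_mul_mul_eq_zero hp (g := fun z => g z.1) (fun z => h z.2) hs.symm, ← hs]
    simp
  rcases ht0.eq_or_lt with ht | ht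
  · have := sum_mul_mul_eq_zero hp (g := fun z => h z.2) (fun z => g z.1) ht.symm
    simp only [mul_comm (h _)] at this
    rw [this, ← ht]
    simp
  set s := √(∑ z, p z * g z.1 ^ 2) with hsdef
  set t := √(∑ z, p z * h z.2 ^ 2) with htdef
  have hs1 : 0 < s := Real.sqrt_pos.mpr hs
  have ht1 : 0 < t := Real.sqrt_pos.mpr ht
  have hss : ∑ z, p z * g z.1 ^ 2 = s ^ 2 := (Real.sq_sqrt hs0).symm
  have htt : ∑ z, p z * h z.2 ^ 2 = t ^ 2 := (Real.sq_sqrt ht0).symm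
  have hle : ‖∑ z, p z * ((g z.1 / s) * (h z.2 / t))‖ₑ ≤ classicalMaxCorr p := by
    refine le_iSup_of_le (fun x => g x / s) <| le_iSup_of_le (fun y => h y / t) <|
      le_iSup_of_le ?_ <| le_iSup_of_le ?_ <| le_iSup_of_le ?_ <| le_iSup_of_le ?_ le_rfl
    · simp only [← mul_div_assoc, ← Finset.sum_div, hg, zero_div]
    · simp only [← mul_div_assoc, ← Finset.sum_div, hh, zero_div]
    · simp only [div_pow, ← mul_div_assoc, ← Finset.sum_div, hss]
      exact div_self (by positivity)
    · simp only [div_pow, ← mul_div_assoc, ← Finset.sum_div, htt]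
      exact div_self (by positivity)
  have h1 : ∑ z, p z * ((g z.1 / s) * (h z.2 / t)) = (∑ z, p z * (g z.1 * h z.2)) / (s * t) := by
    rw [Finset.sum_div]
    exact Finset.sum_congr rfl fun z _ => by field_simp
  have h2 := ENNReal.toReal_mono (classicalMaxCorr_ne_top hp) hle
  rw [toReal_enorm, h1, Real.norm_eq_abs, abs_div, abs_of_pos (mul_pos hs1 ht1),
    div_le_iff₀ (mul_pos hs1 ht1)] at h2
  exact h2

/-- The maximal correlation also bounds the correlation of complex functions. After a rotation by
a phase the correlation is real, and then the real and the imaginary parts contribute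
separately. -/
lemma norm_sum_le_classicalMaxCorr (hp : ∀ z, 0 ≤ p z) {g : a → ℂ} {h : b → ℂ}
    (hg : ∑ z, (p z : ℂ) * g z.1 = 0) (hh : ∑ z, (p z : ℂ) * h z.2 = 0)
    (hg1 : ∑ z, p z * ‖g z.1‖ ^ 2 ≤ 1) (hh1 : ∑ z, p z * ‖h z.2‖ ^ 2 ≤ 1) :
    ‖∑ z, (p z : ℂ) * (g z.1 * star (h z.2))‖ ≤ (classicalMaxCorr p).toReal := by
  obtain ⟨c, hc, hcT⟩ := RCLike.exists_norm_eq_mul_self (∑ z, (p z : ℂ) * (g z.1 * star (h z.2)))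
  set u : a → ℂ := fun x => c * g x with hu
  have hu0 : ∑ z, (p z : ℂ) * u z.1 = 0 := by
    simp only [hu, mul_left_comm _ c, ← Finset.mul_sum, hg, mul_zero]
  have hu1 : ∑ z, p z * ‖u z.1‖ ^ 2 ≤ 1 := by simpa [hu, hc] using hg1
  have hre : ∀ {q : a × b → ℂ}, ∑ z, (p z : ℂ) * q z = 0 → ∑ z, p z * (q z).re = 0 := by
    intro q hq
    simpa using congrArg Complex.re hq
  have him : ∀ {q : a × b → ℂ}, ∑ z, (p z : ℂ) * q z = 0 → ∑ z, p z * (q z).im = 0 := by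
    intro q hq
    simpa using congrArg Complex.im hq
  have hsplit : ∀ q : a × b → ℂ, ∑ z, p z * ‖q z‖ ^ 2 =
      ∑ z, p z * (q z).re ^ 2 + ∑ z, p z * (q z).im ^ 2 := by
    intro q
    rw [← Finset.sum_add_distrib]
    refine Finset.sum_congr rfl fun z _ => ?_
    rw [← Complex.normSq_eq_norm_sq, Complex.normSq_apply]
    ring
  have hT : ‖∑ z, (p z : ℂ) * (g z.1 * star (h z.2))‖ =
      ∑ z, p z * ((u z.1).re * (h z.2).re) + ∑ z, p z * ((u z.1).im * (h z.2).im) := by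
    have h1 := congrArg Complex.re hcT
    rw [Finset.mul_sum, Complex.re_sum] at h1
    rw [← Finset.sum_add_distrib]
    refine Eq.trans (by simp) (h1.trans (Finset.sum_congr rfl fun z _ => ?_))
    have h2 : c * ((p z : ℂ) * (g z.1 * star (h z.2))) = (p z : ℂ) * (u z.1 * star (h z.2)) := by
      simp only [hu]
      ring
    rw [h2, Complex.re_ofReal_mul, Complex.mul_re]
    simp
    ring
  have hR := (le_abs_self _).trans (abs_sum_le_classicalMaxCorr hp (g := fun x => (u x).re)
    (h := fun y => (h y).re) (hre hu0) (hre hh))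
  have hI := (le_abs_self _).trans (abs_sum_le_classicalMaxCorr hp (g := fun x => (u x).im)
    (h := fun y => (h y).im) (him hu0) (him hh))
  rw [hsplit] at hu1 hh1
  have hm : 0 ≤ (classicalMaxCorr p).toReal := ENNReal.toReal_nonneg
  have hsq : ∀ q : a × b → ℝ, √(∑ z, p z * q z ^ 2) ^ 2 = ∑ z, p z * q z ^ 2 := fun q =>
    Real.sq_sqrt (Finset.sum_nonneg fun z _ => mul_nonneg (hp z) (sq_nonneg _))
  rw [hT]
  refine (add_le_add hR hI).trans ?_
  rw [← mul_add]
  refine mul_le_of_le_one_right hm ?_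
  have e1 := hsq fun z => (u z.1).re
  have e2 := hsq fun z => (u z.1).im
  have e3 := hsq fun z => (h z.2).re
  have e4 := hsq fun z => (h z.2).im
  have f1 := two_mul_le_add_sq (√(∑ z, p z * (u z.1).re ^ 2)) (√(∑ z, p z * (h z.2).re ^ 2))
  have f2 := two_mul_le_add_sq (√(∑ z, p z * (u z.1).im ^ 2)) (√(∑ z, p z * (h z.2).im ^ 2))
  rw [e1, e3] at f1
  rw [e2, e4] at f2
  linarith

variable [DecidableEq a] [DecidableEq b]

omit [Fintype a] in
lemma marginalA_classicalState (p : a × b → ℝ) :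
    marginalA (classicalState p) = Matrix.diagonal fun x => ((∑ y, p (x, y) : ℝ) : ℂ) := by
  ext i j
  by_cases hij : i = j
  · subst hij
    simp [marginalA, classicalState]
  · simp [marginalA, classicalState, hij]

omit [Fintype b] in
lemma marginalB_classicalState (p : a × b → ℝ) :
    marginalB (classicalState p) = Matrix.diagonal fun y => ((∑ x, p (x, y) : ℝ) : ℂ) := by
  ext i j
  by_cases hij : i = j
  · subst hij
    simp [marginalB, classicalState]
  · simp [marginalB, classicalState, hij]

lemma trace_kronecker_mul_classicalState (X : Matrix a a ℂ) (Y : Matrix b b ℂ) (p : a × b → ℝ) :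
    ((X ⊗ₖ Yᴴ) * classicalState p).trace =
      ∑ z, (p z : ℂ) * (X z.1 z.1 * star (Y z.2 z.2)) := by
  simp only [classicalState, Matrix.trace, Matrix.diag_apply, Matrix.mul_diagonal,
    Matrix.kroneckerMap_apply, Matrix.conjTranspose_apply]
  exact Finset.sum_congr rfl fun z _ => mul_comm _ _

omit [Fintype b] [DecidableEq b] in
lemma innerF_one_diagonal {f : ℝ → ℝ} (hf : NormalizedOperatorMonotone f) {d : a → ℝ}
    (hd : ∀ i, 0 ≤ d i) (X : Matrix a a ℂ) :
    innerF f (Matrix.diagonal fun i => (d i : ℂ)) 1 X = ∑ i, (d i : ℂ) * X i i := by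
  rw [innerF_one hf (Matrix.PosSemidef.diagonal fun i => Complex.zero_le_real.mpr (hd i)),
    Matrix.trace]
  simp [Matrix.diagonal_mul]

omit [Fintype b] [DecidableEq b] in
lemma innerF_self_diagonal (f : ℝ → ℝ) (d : a → ℝ) (X : Matrix a a ℂ) :
    innerF f (Matrix.diagonal fun i => (d i : ℂ)) X X =
      ((∑ i, ∑ j, perspective f (d i) (d j) * ‖X i j‖ ^ 2 : ℝ) : ℂ) := by
  simpa using innerF_self (U := 1) (d := d) (by simp) (by simp) f X

omit [Fintype b] [DecidableEq b] in
/-- For a diagonal `σ`, feasibility passes to the diagonal of an observable, with second moment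
at most `1`. -/
lemma Feasible.diagonal {f : ℝ → ℝ} (hf : NormalizedOperatorMonotone f) {d : a → ℝ}
    (hd : ∀ i, 0 ≤ d i) {X : Matrix a a ℂ}
    (hX : Feasible f (Matrix.diagonal fun i => (d i : ℂ)) X) :
    ∑ i, (d i : ℂ) * X i i = 0 ∧ ∑ i, d i * ‖X i i‖ ^ 2 ≤ 1 := by
  refine ⟨by rw [← innerF_one_diagonal hf hd, hX.1], ?_⟩
  have h1 := hX.2
  rw [innerF_self_diagonal] at h1
  rw [← Complex.ofReal_eq_one.mp h1]
  refine Finset.sum_le_sum fun i _ => ?_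
  have h2 := Finset.single_le_sum (f := fun j => perspective f (d i) (d j) * ‖X i j‖ ^ 2)
    (fun j _ => mul_nonneg (perspective_nonneg hf (hd i) (hd j)) (sq_nonneg _))
    (Finset.mem_univ i)
  simpa only [perspective_self hf (hd i)] using h2

omit [Fintype b] [DecidableEq b] in
lemma feasible_diagonal {f : ℝ → ℝ} (hf : NormalizedOperatorMonotone f) {d : a → ℝ}
    (hd : ∀ i, 0 ≤ d i) {g : a → ℝ} (h0 : ∑ i, d i * g i = 0) (h1 : ∑ i, d i * g i ^ 2 = 1) :
    Feasible f (Matrix.diagonal fun i => (d i : ℂ)) (Matrix.diagonal fun i => (g i : ℂ)) := by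
  constructor
  · rw [innerF_one_diagonal hf hd]
    simp only [Matrix.diagonal_apply_eq]
    exact_mod_cast h0
  · rw [innerF_self_diagonal, Complex.ofReal_eq_one, ← h1]
    refine Finset.sum_congr rfl fun i _ => ?_
    rw [Finset.sum_eq_single i]
    · simp [perspective_self hf (hd i)]
    · intro j _ hj
      simp [Matrix.diagonal_apply_ne _ hj.symm]
    · simp

lemma mu_classicalState {f : ℝ → ℝ} (hf : NormalizedOperatorMonotone f) (hp : ∀ z, 0 ≤ p z) :
    mu f (classicalState p) = classicalMaxCorr p ∧
      muLin f (classicalState p) = classicalMaxCorr p := by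
  have hA : ∀ x, 0 ≤ ∑ y, p (x, y) := fun x => Finset.sum_nonneg fun y _ => hp _
  have hB : ∀ y, 0 ≤ ∑ x, p (x, y) := fun y => Finset.sum_nonneg fun x _ => hp _
  have hlow : classicalMaxCorr p ≤ mu f (classicalState p) := by
    refine iSup_le fun g => iSup_le fun h => iSup_le fun hg0 => iSup_le fun hh0 =>
      iSup_le fun hg1 => iSup_le fun hh1 => ?_
    simp only [Fintype.sum_prod_type] at hg0 hg1
    simp only [Fintype.sum_prod_type_right] at hh0 hh1
    simp only [← Finset.sum_mul] at hg0 hg1 hh0 hh1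
    refine le_iSup_of_le (Matrix.diagonal fun x => (g x : ℂ)) <|
      le_iSup_of_le (Matrix.diagonal fun y => (h y : ℂ)) <|
      le_iSup_of_le (isHermitian_diagonal_ofReal g) <|
      le_iSup_of_le (isHermitian_diagonal_ofReal h) <| le_iSup_of_le ?_ <| le_iSup_of_le ?_ ?_
    · rw [marginalA_classicalState]
      exact feasible_diagonal hf hA hg0 hg1
    · rw [marginalB_classicalState]
      exact feasible_diagonal hf hB hh0 hh1
    · rw [trace_kronecker_mul_classicalState]
      refine le_of_eq ?_
      rw [← ofReal_norm, ← ofReal_norm, ← Complex.norm_real]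
      simp
  have hhigh : muLin f (classicalState p) ≤ classicalMaxCorr p := by
    refine iSup_le fun X => iSup_le fun Y => iSup_le fun hX => iSup_le fun hY => ?_
    rw [marginalA_classicalState] at hX
    rw [marginalB_classicalState] at hY
    obtain ⟨hX0, hX1⟩ := hX.diagonal hf hA
    obtain ⟨hY0, hY1⟩ := hY.diagonal hf hB
    rw [trace_kronecker_mul_classicalState, ← ofReal_norm]
    refine ENNReal.ofReal_le_of_le_toReal (norm_sum_le_classicalMaxCorr hp
      (g := fun x => X x x) (h := fun y => Y y y) ?_ ?_ ?_ ?_)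
    · rw [Fintype.sum_prod_type, ← hX0]
      push_cast
      simp only [Finset.sum_mul]
    · rw [Fintype.sum_prod_type_right, ← hY0]
      push_cast
      simp only [Finset.sum_mul]
    · simpa only [Fintype.sum_prod_type, Finset.sum_mul] using hX1
    · simpa only [Fintype.sum_prod_type_right, Finset.sum_mul] using hY1
  exact ⟨le_antisymm ((mu_le_muLin f _).trans hhigh) hlow,
    le_antisymm hhigh (hlow.trans (mu_le_muLin f _))⟩

end Classical

end MaxCorr

theorem mainTheorem5 {a b a' b' : Type*}
    [Fintype a] [DecidableEq a] [Fintype b] [DecidableEq b]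
    [Fintype a'] [DecidableEq a'] [Fintype b'] [DecidableEq b']
    (f : ℝ → ℝ) (hf : MaxCorr.NormalizedOperatorMonotone f) :
    (∀ ρ : Matrix (a × b) (a × b) ℂ, MaxCorr.IsState ρ →
      MaxCorr.mu f ρ ≠ ⊤ ∧ MaxCorr.muLin f ρ ≠ ⊤) ∧
    (∀ (ρ : Matrix (a × b) (a × b) ℂ)
        (E : Matrix a a ℂ →ₗ[ℂ] Matrix a' a' ℂ) (F : Matrix b b ℂ →ₗ[ℂ] Matrix b' b' ℂ),
      MaxCorr.IsState ρ →
      MaxCorr.IsAdjointOfUnitalSchwarz E → MaxCorr.IsAdjointOfUnitalSchwarz F →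
      MaxCorr.mu f (MaxCorr.tensorMap E F ρ) ≤ MaxCorr.mu f ρ ∧
      MaxCorr.muLin f (MaxCorr.tensorMap E F ρ) ≤ MaxCorr.muLin f ρ) ∧
    (∀ (ρ : Matrix (a × b) (a × b) ℂ) (V : Matrix a' a ℂ) (W : Matrix b' b ℂ),
      MaxCorr.IsState ρ → Vᴴ * V = 1 → Wᴴ * W = 1 →
      MaxCorr.mu f ρ = MaxCorr.mu f ((V ⊗ₖ W) * ρ * (Vᴴ ⊗ₖ Wᴴ)) ∧
      MaxCorr.muLin f ρ = MaxCorr.muLin f ((V ⊗ₖ W) * ρ * (Vᴴ ⊗ₖ Wᴴ))) ∧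
    (∀ p : a × b → ℝ, MaxCorr.IsDistribution p →
      MaxCorr.mu f (MaxCorr.classicalState p) = MaxCorr.classicalMaxCorr p ∧
      MaxCorr.muLin f (MaxCorr.classicalState p) = MaxCorr.classicalMaxCorr p) := by
  refine ⟨fun ρ hρ => ?_, fun ρ E F hρ hE hF => MaxCorr.data_processing hf hρ.1 hE hF,
    fun ρ V W hρ hV hW => MaxCorr.isometric_invariance hf hρ hV hW,
    fun p hp => MaxCorr.mu_classicalState hf hp.1⟩
  have h := MaxCorr.muLin_ne_top hf hρ.1
  exact ⟨ne_top_of_le_ne_top h (MaxCorr.mu_le_muLin f ρ), h⟩
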